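/- **Notation.** Let $\mathbf x\sim\mathcal N(\mathbf 0,\mathbf I)$ in $\mathbb R^d$; for a subspace $V\subseteq\mathbb R^d$ write $\mathbf x^V$ for the orthogonal projection of $\mathbf x$ onto $V$. For Borel $A\subseteq\mathbb R^d$ let $\Gamma(A)=\liminf_{\delta\to0^+}\Pr[\mathbf x\in A_\delta\setminus A]/\delta$, where $A_\delta=\{\mathbf x:\mathrm{dist}(\mathbf x,A)\le\delta\}$. For a finite $\mathcal Y\subseteq\mathbb Z$ and $f:\mathbb R^d\to\mathcal Y$ Borel, let $\Gamma(f)=\sum_{z\in\mathcal Y}\Gamma(f^{-1}(z))$. **Definition.** A class $\mathcal F$ of Borel functions $\mathbb R^d\to\mathcal Y$ is a class of *$(m,\zeta,\alpha,K,\tau,\sigma,\Gamma)$-well-behaved multi-index models* if every $f\in\mathcal F$ satisfies $\Gamma(f)\le\Gamma$ and there is a subspace $W\subseteq\mathbb R^d$ with $\dim W\le K$ such that $f(\mathbf x)=f(\mathbf x^W)$ for all $\mathbf x\in\mathbb R^d$ and such that, for every random label $y\in\mathcal Y$ (jointly distributed with $\mathbf x$) with $\Pr[f(\mathbf x)\ne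 y]\le\zeta$ and every subspace $V\subseteq\mathbb R^d$, at least one of the following holds: (a) there is a Borel $g:V\to\mathcal Y$ with $\Pr[g(\mathbf x^V)\ne f(\mathbf x)]\le\tau$; or (b) with probability at least $\alpha$ over $\mathbf x_0\sim\mathcal N(\mathbf 0,\mathbf I)$ (independent of $\mathbf x$) there are a polynomial $p:U\to\mathbb R$ of degree at most $m$, where $U=(V+W)\cap V^\perp$, and a label $z\in\mathcal Y$ such that $\mathbb E[p(\mathbf x^U)]=0$ and $$\mathbb E\big[p(\mathbf x^U)\,\mathbf 1(y=z)\,\big|\,\mathbf x^V=\mathbf x_0^V\big]>\sigma\,\big(\mathbb E[p(\mathbf x^U)^2]\big)^{1/2}.$$ Let $\mathcal F_{K,d}$ be the class of intersections of $K$ halfspaces in $\mathbb R^d$, i.e. of the functions $f:\mathbb R^d\to\{0,1\}$, $f(\mathbf x)=\prod_{i=1}^K\mathbf 1(\mathbf w^{(i)}\cdot\mathbf x+t_i\ge0)$ with $\mathbf w^{(i)}\in\mathbb R^d$, $t_i\in\mathbb R$. **Proposition 4.2.** There are universal constants $C>0$, $c\in(0,1)$ and $q\in\mathbb N$ such that for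 all integers $d,K\ge1$ and all $\zeta,\epsilon\in(0,1)$, the class $\mathcal F_{K,d}$ (with $\mathcal Y=\{0,1\}$) is a class of $$\Big(2,\ \zeta,\ \epsilon,\ K,\ C K\,\zeta\log(1/\zeta+1)+\epsilon,\ c\,(\epsilon/K)^q,\ C\sqrt{\log(K+1)}\Big)\text{-well-behaved}$$ multi-index models. (If $\tau=CK\zeta\log(1/\zeta+1)+\epsilon\ge1$, alternative (a) holds trivially.) -/

import Mathlib

open MeasureTheory ProbabilityTheory Filter Topology
open scoped InnerProductSpace

noncomputable section

/-- The space `ℝ^d` with its Euclidean structure. -/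
abbrev RSpace (d : ℕ) : Type := EuclideanSpace ℝ (Fin d)

/-- Gaussian surface area of a set `A ⊆ ℝ^d`:
`liminf_{δ → 0+} Pr_{x ∼ N(0, I)}[x ∈ A_δ \ A] / δ`, where `A_δ = {x : dist(x, A) ≤ δ}`
(which is empty when `A` is empty). -/
def gaussianSurfaceArea {d : ℕ} (A : Set (RSpace d)) : ENNReal :=
  liminf (fun δ : ℝ => stdGaussian (RSpace d) (Metric.cthickening δ A \ A) / ENNReal.ofReal δ)
    (𝓝[>] (0 : ℝ))

/-- Gaussian surface area of a multiclass function with labels in `𝒴`: the sum of the Gaussian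
surface areas of its label sets. -/
def multiclassSurfaceArea {d : ℕ} (𝒴 : Finset ℤ) (f : RSpace d → ℤ) : ENNReal :=
  ∑ z ∈ 𝒴, gaussianSurfaceArea {x | f x = z}

/-- `p : U → ℝ` is a polynomial of degree at most `m` on the subspace `U ⊆ ℝ^d`. Polynomials on `U`
are exactly the restrictions to `U` of polynomials of the same degree in the coordinates
of `ℝ^d`. -/
def IsPolynomialOn {d : ℕ} (U : Submodule ℝ (RSpace d)) (m : ℕ) (p : U → ℝ) : Prop :=
  ∃ q : MvPolynomial (Fin d) ℝ, q.totalDegree ≤ m ∧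
    ∀ u : U, p u = MvPolynomial.eval (fun i => (u : RSpace d) i) q

/-- The joint distribution `D` of a pair `(x, y)` with `x ∼ N(0, I)` in `ℝ^d` and with `y` a random
label supported on `𝒴`. -/
structure IsLabeledGaussian {d : ℕ} (𝒴 : Finset ℤ) (D : Measure (RSpace d × ℤ)) : Prop where
  marginal : D.map Prod.fst = stdGaussian (RSpace d)
  label_mem : ∀ᵐ ω ∂D, ω.2 ∈ 𝒴

/-- The regular conditional distribution of `(x, y) ∼ D` given the projection `x^V`, as a kernel
from `V`. -/
def condOnProj {d : ℕ} (D : Measure (RSpace d × ℤ)) [IsProbabilityMeasure D]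
    (V : Submodule ℝ (RSpace d)) : Kernel V (RSpace d × ℤ) :=
  condDistrib (fun ω : RSpace d × ℤ => ω)
    (fun ω : RSpace d × ℤ => V.orthogonalProjectionOnto ω.1) D

/-- At the point `x₀` there is a polynomial `p : U → ℝ` of degree at most `m`, with `p(x^U)` of mean
zero, and a label `z ∈ 𝒴` such that
`E[p(x^U) 1(y = z) | x^V = x₀^V] > σ ‖p(x^U)‖₂`. -/
def HasMoment {d : ℕ} (𝒴 : Finset ℤ) (m : ℕ) (σ : ℝ) (D : Measure (RSpace d × ℤ))
    [IsProbabilityMeasure D] (V U : Submodule ℝ (RSpace d)) (x₀ : RSpace d) : Prop :=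
  ∃ p : U → ℝ, IsPolynomialOn U m p ∧ ∃ z ∈ 𝒴,
    ∫ x, p (U.orthogonalProjectionOnto x) ∂(stdGaussian (RSpace d)) = 0 ∧
    σ * √(∫ x, p (U.orthogonalProjectionOnto x) ^ 2 ∂(stdGaussian (RSpace d))) <
      ∫ ω, p (U.orthogonalProjectionOnto ω.1) * Set.indicator {k : ℤ | k = z} (fun _ => (1 : ℝ)) ω.2
        ∂(condOnProj D V (V.orthogonalProjectionOnto x₀))

/-- A class `F` of (Borel) functions `ℝ^d → 𝒴` is a class of
`(m, ζ, α, K, τ, σ, Γ)`-well-behaved multi-index models. -/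
def IsWellBehaved {d : ℕ} (𝒴 : Finset ℤ) (F : Set (RSpace d → ℤ))
    (m : ℕ) (ζ α : ℝ) (K : ℕ) (τ σ Γ : ℝ) : Prop :=
  ∀ f ∈ F, Measurable f ∧ (∀ x, f x ∈ 𝒴) ∧
    multiclassSurfaceArea 𝒴 f ≤ ENNReal.ofReal Γ ∧
    ∃ W : Submodule ℝ (RSpace d), Module.finrank ℝ W ≤ K ∧
      (∀ x, f x = f (W.orthogonalProjectionOnto x)) ∧
      ∀ (D : Measure (RSpace d × ℤ)) [IsProbabilityMeasure D], IsLabeledGaussian 𝒴 D →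
        D {ω | f ω.1 ≠ ω.2} ≤ ENNReal.ofReal ζ →
        ∀ V : Submodule ℝ (RSpace d),
          (∃ g : V → ℤ, Measurable g ∧ (∀ v, g v ∈ 𝒴) ∧
            stdGaussian (RSpace d) {x | g (V.orthogonalProjectionOnto x) ≠ f x} ≤ ENNReal.ofReal τ) ∨
          ENNReal.ofReal α ≤
            stdGaussian (RSpace d) {x₀ | HasMoment 𝒴 m σ D V ((V ⊔ W) ⊓ Vᗮ) x₀}

/-- The class of intersections of `K` halfspaces of `ℝ^d`: the functions
`f(x) = ∏_{i ≤ K} 1(w⁽ⁱ⁾ · x + t_i ≥ 0)`. -/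
def intersectionsOfHalfspaces (K d : ℕ) : Set (RSpace d → ℤ) :=
  {f | ∃ (w : Fin K → RSpace d) (t : Fin K → ℝ),
    f = Set.indicator {x | ∀ i, 0 ≤ ⟪w i, x⟫_ℝ + t i} (fun _ => (1 : ℤ))}

end

/-! Surface area. Nazarov's argument bounds the Gaussian mass of a shell of width `δ` at the
boundary of a polyhedron by `O(δ √log (K + 1))` (`stdGaussian_shell_le`). The space is cut into
cells according to which constraint is tightest. Facets farther than `2 √log (K + 1)` from the
origin are paid for by Gaussian decay, and every other facet is charged to the part of its own cell
behind it.

Moments. Let `W` be the span of the normals. On a fibre `x^V = v` the set is again an intersection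
of `K` halfspaces, now with normals in `Vᗮ`; let `β` be its conditional Gaussian mass. Rounding `β`
to the nearer of `0` and `1` gives a function of `x^V` with error `E[min β (1 - β)]`
(`exists_majority`). So if (a) fails, this mean exceeds `τ`, and it is enough to find a good
quadratic on each fibre where `min β (1 - β)` dominates the conditional label noise. An averaging
argument shows that such fibres have probability at least `ε`.

One fibre. By a union bound some facet, with unit normal `e`, cuts off Gaussian mass at least `(1 -
β) / K` (`exists_facet`). By Prékopa–Leindler the slices of a convex set `A` orthogonal to `e` have
log-concave Gaussian measure, and they vanish beyond the facet. A density that is log-concave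
relative to the Gaussian has variance at most `1`, with a deficit bounded below by the missing tail
(`exists_variance_contraction`). Hence, with `μ` the mean of `⟪e, x⟫` over `A`, the quadratic `1 -
⟪e, x⟫² + μ ⟪e, x⟫` has integral over `A` at least a constant times `β` times the tail beyond the
facet shifted by `μ`. If `|μ| ≤ 1 / √L`, where `L` is the logarithm of the inverse noise rate, the
shift costs only a constant factor (`exists_tail_shift`). If `|μ|` is larger, the linear form `± ⟪e,
x⟫` already correlates enough.

Noise. Truncating Gaussian moments at a fixed level `L` bounds the effect of mislabelled points on a
fibre by an expression affine in their conditional probability `z` (`exists_noise_bound`), so the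
bound can be averaged over fibres. The rate is first raised to `max ζ (c₀ ε / K)²`, which keeps `1 /
√L` of order at least `ε / K`; this is where the exponent `q = 2` comes from. -/

/-! ### Brunn–Minkowski and Prékopa–Leindler on the line. -/

/-- One-dimensional Brunn–Minkowski inequality. -/
theorem volume_brunnMinkowski_real {S₁ S₂ S : Set ℝ} (h₁ : MeasurableSet S₁)
    (h₂ : MeasurableSet S₂) (n₁ : S₁.Nonempty) (n₂ : S₂.Nonempty) {a b : ℝ} (ha : 0 < a)
    (hb : 0 < b) (hS : ∀ x ∈ S₁, ∀ y ∈ S₂, a * x + b * y ∈ S) :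
    ENNReal.ofReal a * volume S₁ + ENNReal.ofReal b * volume S₂ ≤ volume S := by
  -- For compact sets, translate `a K₁` by `b min K₂` and `b K₂` by `a max K₁`. Both copies lie in
  -- `S` and meet in at most one point, so their lengths add.
  have key : ∀ K₁ : Set ℝ, K₁ ⊆ S₁ → IsCompact K₁ → K₁.Nonempty → ∀ K₂ : Set ℝ, K₂ ⊆ S₂ →
      IsCompact K₂ → K₂.Nonempty →
      ENNReal.ofReal a * volume K₁ + ENNReal.ofReal b * volume K₂ ≤ volume S := by
    intro K₁ s₁ c₁ m₁ K₂ s₂ c₂ m₂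
    obtain ⟨x, hx, hxm⟩ := c₁.exists_isGreatest m₁
    obtain ⟨y, hy, hym⟩ := c₂.exists_isLeast m₂
    have e₁ : volume ((fun t => a * t + b * y) '' K₁) = ENNReal.ofReal a * volume K₁ := by
      have : (fun t => a * t + b * y) '' K₁ = (fun t => t + b * y) '' ((fun t => a * t) '' K₁) := by
        rw [Set.image_image]
      rw [this, Set.image_add_right, measure_preimage_add_right]
      have := Measure.addHaar_smul volume a K₁
      rw [Module.finrank_self, pow_one, abs_of_pos ha] at this
      exact this
    have e₂ : volume ((fun t => a * x + b * t) '' K₂) = ENNReal.ofReal b * volume K₂ := by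
      have : (fun t => a * x + b * t) '' K₂ = (fun t => a * x + t) '' ((fun t => b * t) '' K₂) := by
        rw [Set.image_image]
      rw [this, Set.image_add_left, measure_preimage_add]
      have := Measure.addHaar_smul volume b K₂
      rw [Module.finrank_self, pow_one, abs_of_pos hb] at this
      exact this
    rw [← e₁, ← e₂]
    set c := a * x + b * y
    have i₁ : (fun t => a * t + b * y) '' K₁ ⊆ S ∩ Set.Iic c := by
      rintro _ ⟨t, ht, rfl⟩
      refine ⟨hS _ (s₁ ht) _ (s₂ hy), ?_⟩
      have := hxm ht
      simp only [Set.mem_Iic, c]; gcongr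
    have i₂ : (fun t => a * x + b * t) '' K₂ ⊆ S ∩ Set.Ici c := by
      rintro _ ⟨t, ht, rfl⟩
      refine ⟨hS _ (s₁ hx) _ (s₂ ht), ?_⟩
      have := hym ht
      simp only [Set.mem_Ici, c]; gcongr
    have i₁' : volume ((fun t => a * t + b * y) '' K₁) ≤ volume (S ∩ Set.Iic c) := measure_mono i₁
    have i₂' : volume ((fun t => a * x + b * t) '' K₂) ≤ volume (S ∩ Set.Ioi c) := by
      refine (measure_mono i₂).trans (measure_mono_ae ?_)
      filter_upwards [Measure.ae_ne volume c] with t ht h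
      exact ⟨h.1, lt_of_le_of_ne h.2 (Ne.symm ht)⟩
    refine (add_le_add i₁' i₂').trans ?_
    have := measure_inter_add_sdiff (μ := volume) S (measurableSet_Iic (a := c))
    rw [← this]
    gcongr
    intro t ht; exact ⟨ht.1, by simpa using ht.2⟩
  rw [h₁.measure_eq_iSup_isCompact, h₂.measure_eq_iSup_isCompact]
  simp only [ENNReal.mul_iSup]
  obtain ⟨x, hx⟩ := n₁
  obtain ⟨y, hy⟩ := n₂
  have vx : ∀ z : ℝ, volume ({z} : Set ℝ) = 0 := fun z => by simp
  have P : ∀ (K₁ : Set ℝ), K₁ ⊆ S₁ → IsCompact K₁ → ∀ K₂ : Set ℝ, K₂ ⊆ S₂ → IsCompact K₂ →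
      ENNReal.ofReal a * volume K₁ + ENNReal.ofReal b * volume K₂ ≤ volume S := by
    intro K₁ s₁ c₁ K₂ s₂ c₂
    refine le_trans ?_ (key (insert x K₁) (Set.insert_subset hx s₁) (c₁.insert x) ⟨x, by simp⟩
      (insert y K₂) (Set.insert_subset hy s₂) (c₂.insert y) ⟨y, by simp⟩)
    gcongr <;> exact Set.subset_insert _ _
  simp only [iSup_and']
  refine ENNReal.biSup_add_biSup_le' ⟨∅, by simp⟩ ⟨∅, by simp⟩ ?_
  intro K₁ h₁ K₂ h₂
  exact P K₁ h₁.1 h₁.2 K₂ h₂.1 h₂.2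

/-- One-dimensional Prékopa–Leindler inequality for bounded functions. -/
theorem prekopaLeindler_real {u v w : ℝ → ℝ} (hu : Measurable u) (hv : Measurable v)
    (u0 : ∀ x, 0 ≤ u x) (v0 : ∀ x, 0 ≤ v x) (w0 : ∀ x, 0 ≤ w x)
    (bu : BddAbove (Set.range u)) (bv : BddAbove (Set.range v))
    (iu : Integrable u) (iv : Integrable v) (iw : Integrable w)
    {a b : ℝ} (ha : 0 < a) (hb : 0 < b) (hab : a + b = 1)
    (h : ∀ x y, u x ^ a * v y ^ b ≤ w (a * x + b * y)) :
    (∫ x, u x) ^ a * (∫ x, v x) ^ b ≤ ∫ x, w x := by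
  have wi : 0 ≤ ∫ x, w x := integral_nonneg w0
  have ui : 0 ≤ ∫ x, u x := integral_nonneg u0
  have vi : 0 ≤ ∫ x, v x := integral_nonneg v0
  rcases ui.eq_or_lt with hu0 | hup
  · rw [← hu0, Real.zero_rpow ha.ne', zero_mul]; exact wi
  rcases vi.eq_or_lt with hv0 | hvp
  · rw [← hv0, Real.zero_rpow hb.ne', mul_zero]; exact wi
  have pos_sup : ∀ g : ℝ → ℝ, (∀ x, 0 ≤ g x) → BddAbove (Set.range g) → 0 < ∫ x, g x →
      0 < sSup (Set.range g) := by
    intro g g0 bg hg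
    by_contra hc
    have : ∀ x, g x = 0 := fun x => le_antisymm ((le_csSup bg ⟨x, rfl⟩).trans (not_lt.1 hc)) (g0 x)
    simp [this] at hg
  set M := sSup (Set.range u)
  set N := sSup (Set.range v)
  have hM : 0 < M := pos_sup u u0 bu hup
  have hN : 0 < N := pos_sup v v0 bv hvp
  set R := M ^ a * N ^ b
  have hR : 0 < R := by positivity
  -- Dividing by the suprema makes both superlevel sets nonempty for exactly the levels `t < 1`, so
  -- Brunn–Minkowski applies at each level. The resulting arithmetic-mean inequality is stronger
  -- than the geometric one.
  have lay : ENNReal.ofReal a * (∫⁻ x, ENNReal.ofReal (u x / M)) +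
      ENNReal.ofReal b * (∫⁻ x, ENNReal.ofReal (v x / N)) ≤ ∫⁻ x, ENNReal.ofReal (w x / R) := by
    rw [lintegral_eq_lintegral_meas_lt volume (ae_of_all _ fun x => div_nonneg (u0 x) hM.le)
        (hu.div_const _).aemeasurable,
      lintegral_eq_lintegral_meas_lt volume (ae_of_all _ fun x => div_nonneg (v0 x) hN.le)
        (hv.div_const _).aemeasurable,
      lintegral_eq_lintegral_meas_lt volume (ae_of_all _ fun x => div_nonneg (w0 x) hR.le)
        (iw.aestronglyMeasurable.aemeasurable.div_const _)]
    have am : ∀ g : ℝ → ℝ, Measurable fun t : ℝ => volume {x | t < g x} := fun g =>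
      (Antitone.measurable fun s t hst => measure_mono fun x (hx : t < g x) => lt_of_le_of_lt hst hx)
    rw [← lintegral_const_mul _ (am _), ← lintegral_const_mul _ (am _),
      ← lintegral_add_left ((am _).const_mul _)]
    refine setLIntegral_mono' measurableSet_Ioi fun t (ht : 0 < t) => ?_
    by_cases ht1 : t < 1
    · have ne : ∀ g : ℝ → ℝ, BddAbove (Set.range g) → 0 < sSup (Set.range g) →
          {x | t < g x / sSup (Set.range g)}.Nonempty := by
        intro g bg hg
        obtain ⟨_, ⟨x, rfl⟩, hx⟩ := exists_lt_of_lt_csSup (Set.range_nonempty g)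
          (show t * sSup (Set.range g) < sSup (Set.range g) by nlinarith)
        exact ⟨x, by rwa [Set.mem_ofPred_eq, lt_div_iff₀ hg]⟩
      refine volume_brunnMinkowski_real (measurableSet_lt measurable_const (hu.div_const _))
        (measurableSet_lt measurable_const (hv.div_const _)) (ne u bu hM) (ne v bv hN) ha hb ?_
      intro x (hx : t < u x / M) y (hy : t < v y / N)
      show t < w _ / R
      have h1 : t = t ^ a * t ^ b := by rw [← Real.rpow_add ht, hab, Real.rpow_one]
      rw [h1]
      calc t ^ a * t ^ b < (u x / M) ^ a * (v y / N) ^ b :=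
            mul_lt_mul'' (Real.rpow_lt_rpow ht.le hx ha) (Real.rpow_lt_rpow ht.le hy hb)
              (by positivity) (by positivity)
        _ = u x ^ a * v y ^ b / R := by
            rw [Real.div_rpow (u0 x) hM.le, Real.div_rpow (v0 y) hN.le]; simp only [R]; field_simp
        _ ≤ _ := by gcongr; exact h x y
    · have em : ∀ g : ℝ → ℝ, BddAbove (Set.range g) → 0 < sSup (Set.range g) →
          {x | t < g x / sSup (Set.range g)} = ∅ := by
        intro g bg hg
        ext x
        simp only [Set.mem_ofPred_eq, Set.mem_empty_iff_false, iff_false, not_lt]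
        exact ((div_le_one hg).2 (le_csSup bg ⟨x, rfl⟩)).trans (not_lt.1 ht1)
      rw [em u bu hM, em v bv hN]; simp
  rw [← ofReal_integral_eq_lintegral_ofReal (iu.div_const _)
      (ae_of_all _ fun x => div_nonneg (u0 x) hM.le),
    ← ofReal_integral_eq_lintegral_ofReal (iv.div_const _)
      (ae_of_all _ fun x => div_nonneg (v0 x) hN.le),
    ← ofReal_integral_eq_lintegral_ofReal (iw.div_const _)
      (ae_of_all _ fun x => div_nonneg (w0 x) hR.le), ← ENNReal.ofReal_mul ha.le,
    ← ENNReal.ofReal_mul hb.le] at lay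
  simp only [integral_div] at lay
  rw [← ENNReal.ofReal_add (by positivity) (by positivity),
    ENNReal.ofReal_le_ofReal_iff (by positivity)] at lay
  have am := Real.geom_mean_le_arith_mean2_weighted ha.le hb.le (div_nonneg ui hM.le)
    (div_nonneg vi hN.le) hab
  have := am.trans lay
  rw [Real.div_rpow ui hM.le, Real.div_rpow vi hN.le, div_mul_div_comm, div_le_div_iff_of_pos_right hR]
    at this
  exact this

/-! ### Log-concave functions and their Gaussian marginals. -/

/-- Log-concavity of a nonnegative function on a real vector space. -/
def IsLogConcave {E : Type*} [AddCommGroup E] [Module ℝ E] (F : E → ℝ) : Prop :=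
  (∀ x, 0 ≤ F x) ∧ ∀ x y (a b : ℝ), 0 < a → 0 < b → a + b = 1 →
    F x ^ a * F y ^ b ≤ F (a • x + b • y)

theorem IsLogConcave.comp_affine {E E' : Type*} [AddCommGroup E] [Module ℝ E] [AddCommGroup E']
    [Module ℝ E'] {F : E → ℝ} (hF : IsLogConcave F) {g : E' → E}
    (hg : ∀ x y (a b : ℝ), a + b = 1 → g (a • x + b • y) = a • g x + b • g y) :
    IsLogConcave fun x => F (g x) :=
  ⟨fun x => hF.1 _, fun x y a b ha hb hab => by
    simpa only [hg x y a b hab] using hF.2 (g x) (g y) a b ha hb hab⟩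

theorem IsLogConcave.mul {E : Type*} [AddCommGroup E] [Module ℝ E] {F G : E → ℝ}
    (hF : IsLogConcave F) (hG : IsLogConcave G) : IsLogConcave fun x => F x * G x :=
  ⟨fun x => mul_nonneg (hF.1 x) (hG.1 x), fun x y a b ha hb hab => by
    rw [Real.mul_rpow (hF.1 x) (hG.1 x), Real.mul_rpow (hF.1 y) (hG.1 y)]
    calc _ = (F x ^ a * F y ^ b) * (G x ^ a * G y ^ b) := by ring
      _ ≤ _ := mul_le_mul (hF.2 x y a b ha hb hab) (hG.2 x y a b ha hb hab)
        (mul_nonneg (Real.rpow_nonneg (hG.1 x) _) (Real.rpow_nonneg (hG.1 y) _)) (hF.1 _)⟩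

theorem isLogConcave_exp_of_concave {E : Type*} [AddCommGroup E] [Module ℝ E] {V : E → ℝ}
    (hV : ConcaveOn ℝ Set.univ V) : IsLogConcave fun x => Real.exp (V x) :=
  ⟨fun x => (Real.exp_pos _).le, fun x y a b ha hb hab => by
    rw [← Real.exp_mul, ← Real.exp_mul, ← Real.exp_add, Real.exp_le_exp]
    have := hV.2 (Set.mem_univ x) (Set.mem_univ y) ha.le hb.le hab
    simp only [smul_eq_mul] at this
    linarith⟩

theorem isLogConcave_indicator {E : Type*} [AddCommGroup E] [Module ℝ E] {A : Set E}
    (hA : Convex ℝ A) : IsLogConcave (A.indicator fun _ => (1 : ℝ)) := by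
  refine ⟨fun x => Set.indicator_nonneg (fun _ _ => zero_le_one) _, fun x y a b ha hb hab => ?_⟩
  by_cases hx : x ∈ A
  · by_cases hy : y ∈ A
    · simp [hx, hy, hA hx hy ha.le hb.le hab]
    · simp [hx, hy, Real.zero_rpow hb.ne']
      exact Set.indicator_nonneg (fun _ _ => zero_le_one) _
  · simp [hx, Real.zero_rpow ha.ne']
    exact Set.indicator_nonneg (fun _ _ => zero_le_one) _

theorem isLogConcave_gaussianPDFReal : IsLogConcave (gaussianPDFReal 0 1) := by
  have : gaussianPDFReal 0 1 = fun x => Real.exp (-(x ^ 2) / 2 - Real.log (√(2 * Real.pi))) := by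
    ext x
    rw [gaussianPDFReal, Real.exp_sub, Real.exp_log (by positivity)]
    simp; ring
  rw [this]
  apply isLogConcave_exp_of_concave
  refine ⟨convex_univ, fun x _ y _ a b ha hb hab => ?_⟩
  simp only [smul_eq_mul]
  have : b = 1 - a := by linarith
  subst this
  nlinarith [mul_nonneg (mul_nonneg ha hb) (sq_nonneg (x - y))]

/-- Prékopa's theorem for one variable: multiply by the log-concave Gaussian density and apply
Prékopa–Leindler on the fibres. The bound by `1` supplies the integrability and boundedness needed
there. -/
theorem IsLogConcave.integral_gaussianReal {E : Type*} [AddCommGroup E] [Module ℝ E]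
    {F : E × ℝ → ℝ} (hF : IsLogConcave F) (h1 : ∀ z, F z ≤ 1)
    (hm : ∀ e, Measurable fun x => F (e, x)) :
    IsLogConcave fun e => ∫ x, F (e, x) ∂(gaussianReal 0 1) := by
  have eq : ∀ e, ∫ x, F (e, x) ∂(gaussianReal 0 1) = ∫ x, F (e, x) * gaussianPDFReal 0 1 x := by
    intro e
    rw [integral_gaussianReal_eq_integral_smul one_ne_zero]
    simp [mul_comm]
  have p0 : ∀ x, 0 ≤ gaussianPDFReal 0 1 x := gaussianPDFReal_nonneg 0 1
  have i : ∀ e, Integrable fun x => F (e, x) * gaussianPDFReal 0 1 x := fun e =>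
    (integrable_gaussianPDFReal 0 1).mono' ((hm e).mul (by fun_prop)).aestronglyMeasurable
      (ae_of_all _ fun x => by
        rw [Real.norm_of_nonneg (mul_nonneg (hF.1 _) (p0 x))]
        exact mul_le_of_le_one_left (p0 x) (h1 _))
  have bd : ∀ e, BddAbove (Set.range fun x => F (e, x) * gaussianPDFReal 0 1 x) := by
    intro e
    refine ⟨(√(2 * Real.pi))⁻¹, ?_⟩
    rintro _ ⟨x, rfl⟩
    refine (mul_le_of_le_one_left (p0 x) (h1 _)).trans ?_
    rw [gaussianPDFReal]
    simp only [NNReal.coe_one, mul_one]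
    refine mul_le_of_le_one_right (by positivity) (Real.exp_le_one_iff.2 ?_)
    have : 0 ≤ (x - 0) ^ 2 := sq_nonneg _
    linarith
  refine ⟨fun e => integral_nonneg fun x => hF.1 _, fun e₁ e₂ a b ha hb hab => ?_⟩
  simp only [eq]
  refine prekopaLeindler_real ((hm e₁).mul (by fun_prop)) ((hm e₂).mul (by fun_prop))
    (fun x => mul_nonneg (hF.1 _) (p0 x)) (fun x => mul_nonneg (hF.1 _) (p0 x))
    (fun x => mul_nonneg (hF.1 _) (p0 x)) (bd e₁) (bd e₂) (i _) (i _) (i _) ha hb hab ?_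
  intro x y
  simp only [Pi.mul_apply]
  rw [Real.mul_rpow (hF.1 _) (p0 x), Real.mul_rpow (hF.1 _) (p0 y)]
  have h2 := hF.2 (e₁, x) (e₂, y) a b ha hb hab
  have h3 := isLogConcave_gaussianPDFReal.2 x y a b ha hb hab
  simp only [smul_eq_mul, Prod.smul_mk, Prod.mk_add_mk] at h2 h3
  calc _ = (F (e₁, x) ^ a * F (e₂, y) ^ b) *
        (gaussianPDFReal 0 1 x ^ a * gaussianPDFReal 0 1 y ^ b) := by ring
    _ ≤ _ := mul_le_mul h2 h3
      (mul_nonneg (Real.rpow_nonneg (p0 x) _) (Real.rpow_nonneg (p0 y) _)) (hF.1 _)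

/-- Coordinates are integrated out one at a time. The peeled coordinate joins the parameter space,
which is why `E` is quantified inside the induction. -/
theorem IsLogConcave.integral_pi_gaussianReal (d : ℕ) : ∀ {E : Type} [AddCommGroup E] [Module ℝ E]
    {F : E × (Fin d → ℝ) → ℝ}, IsLogConcave F → (∀ z, F z ≤ 1) →
    (∀ e, Measurable fun x => F (e, x)) →
    IsLogConcave fun e => ∫ x, F (e, x) ∂(Measure.pi fun _ : Fin d => gaussianReal 0 1) := by
  induction d with
  | zero =>
    intro E _ _ F hF h1 hm
    have : ∀ e, ∫ x, F (e, x) ∂(Measure.pi fun _ : Fin 0 => gaussianReal 0 1) = F (e, 0) := by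
      intro e
      rw [Measure.pi_of_empty (fun _ : Fin 0 => gaussianReal 0 1) 0]
      simp
    simp only [this]
    exact hF.comp_affine (g := fun e => (e, 0)) fun x y a b _ => by simp
  | succ n ih =>
    intro E _ _ F hF h1 hm
    have mp := (measurePreserving_piFinSuccAbove (fun _ : Fin (n + 1) => gaussianReal 0 1) 0).symm
    have eq : ∀ e, ∫ x, F (e, x) ∂(Measure.pi fun _ : Fin (n + 1) => gaussianReal 0 1) =
        ∫ t, ∫ x, F (e, Fin.cons t x) ∂(Measure.pi fun _ : Fin n => gaussianReal 0 1)
          ∂(gaussianReal 0 1) := by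
      intro e
      rw [← mp.integral_comp' (g := fun x => F (e, x)), integral_prod]
      · simp [MeasurableEquiv.piFinSuccAbove, Fin.insertNthEquiv]
      · refine Integrable.of_bound (C := 1) ?_ (ae_of_all _ fun x => ?_)
        · exact ((hm e).comp (MeasurableEquiv.measurable _)).aestronglyMeasurable
        · rw [Real.norm_of_nonneg (hF.1 _)]; exact h1 _
    simp only [eq]
    have mc : Measurable fun p : ℝ × (Fin n → ℝ) => (Fin.cons p.1 p.2 : Fin (n + 1) → ℝ) := by
      have := (MeasurableEquiv.piFinSuccAbove (fun _ : Fin (n + 1) => ℝ) 0).symm.measurable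
      simpa [MeasurableEquiv.piFinSuccAbove, Fin.insertNthEquiv] using! this
    have lc := ih (E := E × ℝ) (F := fun z => F (z.1.1, Fin.cons z.1.2 z.2))
      (hF.comp_affine fun x y a b _ => by
        ext i
        · simp
        · refine Fin.cases ?_ (fun j => ?_) i <;> simp) (fun z => h1 _)
      (fun e => (hm e.1).comp (mc.comp (measurable_prodMk_left (x := e.2))))
    refine lc.integral_gaussianReal (fun z => ?_) fun e => ?_
    · refine (integral_mono_of_nonneg (ae_of_all _ fun x => hF.1 _) (integrable_const (1 : ℝ))
        (ae_of_all _ fun x => h1 _)).trans ?_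
      simp
    · exact (StronglyMeasurable.integral_prod_right
        (f := fun (t : ℝ) (x : Fin n → ℝ) => F (e, Fin.cons t x))
        (((hm e).comp mc).stronglyMeasurable)).measurable

/-! ### Moments, tails and density of the one-dimensional Gaussian. -/

theorem integrable_pow_gaussianReal (n : ℕ) : Integrable (fun s : ℝ => s ^ n) (gaussianReal 0 1) := by
  have := (memLp_id_gaussianReal (μ := 0) (v := 1) n).integrable_norm_pow'
  refine this.mono' (by fun_prop) (ae_of_all _ fun x => by simp)

theorem integrable_id_gaussianReal' : Integrable (fun s : ℝ => s) (gaussianReal 0 1) := by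
  simpa using integrable_pow_gaussianReal 1

theorem integral_id_gaussianReal' : ∫ s : ℝ, s ∂(gaussianReal 0 1) = 0 := by
  simp

theorem integral_sq_gaussianReal : ∫ s : ℝ, s ^ 2 ∂(gaussianReal 0 1) = 1 := by
  have := variance_id_gaussianReal (μ := 0) (v := 1)
  rw [variance_of_integral_eq_zero (by fun_prop) (by simp)] at this
  simpa using this

theorem integrable_mul_of_le_one {Ω : Type*} {mΩ : MeasurableSpace Ω} {P : Measure Ω} {g h : Ω → ℝ}
    (hg : Integrable g P) (hh : AEStronglyMeasurable h P) (h0 : ∀ x, 0 ≤ h x) (h1 : ∀ x, h x ≤ 1) :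
    Integrable (fun x => g x * h x) P :=
  hg.mul_bdd (c := 1) hh (ae_of_all _ fun x => by
    rw [Real.norm_of_nonneg (h0 x)]; exact h1 x)

theorem gaussianReal_real_Iio_le {a : ℝ} (ha : 0 < a) :
    (gaussianReal 0 1).real (Set.Iio (-a)) ≤ 1 / a ^ 2 := by
  rw [le_div_iff₀ (by positivity), mul_comm, ← integral_sq_gaussianReal]
  refine (mul_le_mul_of_nonneg_left (measureReal_mono ?_) (sq_nonneg a)).trans
    (mul_meas_ge_le_integral_of_nonneg (ae_of_all _ fun s => sq_nonneg s)
      (integrable_pow_gaussianReal 2) (a ^ 2))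
  intro s (hs : s < -a)
  show a ^ 2 ≤ s ^ 2
  nlinarith

theorem gaussianReal_real_neg (S : Set ℝ) (hS : MeasurableSet S) :
    (gaussianReal 0 1).real ((fun x => -x) ⁻¹' S) = (gaussianReal 0 1).real S := by
  have := gaussianReal_map_neg (μ := 0) (v := 1)
  rw [neg_zero] at this
  conv_rhs => rw [← this, map_measureReal_apply (by fun_prop) hS]

theorem gaussianReal_real_Ioi_zero : (gaussianReal 0 1).real (Set.Ioi 0) = 1 / 2 := by
  have h1 := gaussianReal_real_neg (Set.Iio 0) measurableSet_Iio
  have e : (fun x : ℝ => -x) ⁻¹' Set.Iio 0 = Set.Ioi 0 := by ext; simp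
  rw [e] at h1
  have h2 := measureReal_add_measureReal_compl (μ := gaussianReal 0 1) (measurableSet_Ioi (a := (0 : ℝ)))
  have := nullSingletonClass_gaussianReal (μ := 0) (v := 1) one_ne_zero
  have h3 : (gaussianReal 0 1).real (Set.Iic (0 : ℝ)) = (gaussianReal 0 1).real (Set.Iio 0) :=
    measureReal_congr Iio_ae_eq_Iic.symm
  rw [Set.compl_Ioi, h3, ← h1, probReal_univ] at h2
  linarith

theorem gaussianReal_real_pos {U : Set ℝ} (hU : IsOpen U) (hn : U.Nonempty) :
    0 < (gaussianReal 0 1).real U := by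
  have : gaussianReal 0 1 U ≠ 0 := fun h =>
    (hU.measure_pos volume hn).ne' (gaussianReal_absolutelyContinuous' 0 one_ne_zero h)
  exact ENNReal.toReal_pos this (measure_ne_top _ _)

theorem gaussianPDFReal_zero_one (x : ℝ) :
    gaussianPDFReal 0 1 x = (√(2 * Real.pi))⁻¹ * Real.exp (-x ^ 2 / 2) := by
  simp [gaussianPDFReal]

theorem hasDerivAt_gaussianPDFReal (x : ℝ) :
    HasDerivAt (gaussianPDFReal 0 1) (-x * gaussianPDFReal 0 1 x) x := by
  have h : HasDerivAt (fun x : ℝ => (√(2 * Real.pi))⁻¹ * Real.exp (-x ^ 2 / 2))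
      ((√(2 * Real.pi))⁻¹ * (Real.exp (-x ^ 2 / 2) * (-(2 * x) / 2))) x := by
    have : HasDerivAt (fun x : ℝ => -x ^ 2 / 2) (-(2 * x) / 2) x := by
      simpa using ((hasDerivAt_pow 2 x).neg.div_const 2)
    exact this.exp.const_mul _
  have e : gaussianPDFReal 0 1 = fun x : ℝ => (√(2 * Real.pi))⁻¹ * Real.exp (-x ^ 2 / 2) :=
    funext gaussianPDFReal_zero_one
  rw [e]
  convert h using 1
  ring

theorem tendsto_pow_mul_gaussianPDFReal_atBot :
    Tendsto (fun x => x * gaussianPDFReal 0 1 x) atBot (𝓝 0) ∧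
    Tendsto (fun x => gaussianPDFReal 0 1 x) atBot (𝓝 0) := by
  have key : ∀ k : ℕ, Tendsto (fun x : ℝ => x ^ k * Real.exp (-x ^ 2 / 2)) atBot (𝓝 0) := by
    intro k
    have h := (rpow_mul_exp_neg_mul_sq_isLittleO_exp_neg (b := 1 / 2) (by norm_num) (k : ℝ))
    have h2 : Tendsto (fun x : ℝ => x ^ (k : ℝ) * Real.exp (-(1 / 2) * x ^ 2)) atTop (𝓝 0) := by
      refine h.trans_tendsto ?_
      exact Real.tendsto_exp_atBot.comp (tendsto_id.const_mul_atTop_of_neg (by norm_num))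
    have h3 := h2.comp tendsto_neg_atBot_atTop
    have h4 := (h3.const_mul ((-1) ^ k))
    rw [mul_zero] at h4
    refine h4.congr fun x => ?_
    simp only [Function.comp, Real.rpow_natCast]
    rw [show -(1 / 2) * (-x) ^ 2 = -x ^ 2 / 2 by ring, ← mul_assoc, ← mul_pow]
    simp
  have h0 := (key 0).const_mul (√(2 * Real.pi))⁻¹
  have h1 := (key 1).const_mul (√(2 * Real.pi))⁻¹
  rw [mul_zero] at h0 h1
  refine ⟨h1.congr fun x => ?_, h0.congr fun x => ?_⟩
  · rw [gaussianPDFReal_zero_one]; ring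
  · rw [gaussianPDFReal_zero_one]; ring

theorem setIntegral_gaussianReal (S : Set ℝ) (hS : MeasurableSet S) (g : ℝ → ℝ) :
    ∫ x in S, g x ∂(gaussianReal 0 1) = ∫ x in S, g x * gaussianPDFReal 0 1 x := by
  rw [← integral_indicator hS, integral_gaussianReal_eq_integral_smul one_ne_zero,
    ← integral_indicator hS]
  congr 1; ext x
  by_cases hx : x ∈ S <;> simp [hx, mul_comm]

theorem integrable_gaussianReal_iff (g : ℝ → ℝ) :
    Integrable g (gaussianReal 0 1) ↔ Integrable fun x => g x * gaussianPDFReal 0 1 x := by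
  rw [gaussianReal_of_var_ne_zero _ one_ne_zero,
    integrable_withDensity_iff (measurable_gaussianPDF 0 1) (ae_of_all _ fun x => gaussianPDF_lt_top)]
  simp

/-- Integration by parts: with `φ` the Gaussian density, `(1 - s (s + T)) φ(s)` is the derivative of
`(s + T) φ(s)`, which vanishes at `-T` and at `-∞`. -/
theorem setIntegral_Iio_gaussianReal (T : ℝ) :
    ∫ s in Set.Iio (-T), s * (s + T) ∂(gaussianReal 0 1) =
      (gaussianReal 0 1).real (Set.Iio (-T)) := by
  have i2 : Integrable (fun s => s * (s + T)) (gaussianReal 0 1) := by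
    have := (integrable_pow_gaussianReal 2).add (integrable_id_gaussianReal'.mul_const T)
    refine this.congr (ae_of_all _ fun s => ?_)
    simp only [Pi.add_apply]; ring
  have main : ∫ s in Set.Iic (-T), (1 - s * (s + T)) * gaussianPDFReal 0 1 s =
      (-T + T) * gaussianPDFReal 0 1 (-T) - 0 := by
    refine integral_Iic_of_hasDerivAt_of_tendsto' (f := fun s => (s + T) * gaussianPDFReal 0 1 s)
      (fun s _ => ?_) ?_ ?_
    · refine (((hasDerivAt_id s).add_const T).mul (hasDerivAt_gaussianPDFReal s)).congr_deriv ?_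
      simp only [id]; ring
    · exact ((integrable_gaussianReal_iff _).1 ((integrable_const (1 : ℝ)).sub i2)).integrableOn
    · have := tendsto_pow_mul_gaussianPDFReal_atBot.1.add
        (tendsto_pow_mul_gaussianPDFReal_atBot.2.const_mul T)
      rw [mul_zero, zero_add] at this
      exact this.congr fun x => by ring
  rw [integral_Iic_eq_integral_Iio, ← setIntegral_gaussianReal _ measurableSet_Iio,
    integral_sub (integrable_const _).integrableOn i2.integrableOn] at main
  simp at main
  linarith

/-! ### Variance contraction for log-concave densities. -/

theorem IsLogConcave.ordConnected_superlevel {q : ℝ → ℝ} (hq : IsLogConcave q) :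
    Set.OrdConnected {s | 1 ≤ q s} := by
  have : Convex ℝ {s | 1 ≤ q s} := by
    rw [convex_iff_forall_pos]
    intro x hx y hy a b ha hb hab
    refine le_trans ?_ (hq.2 x y a b ha hb hab)
    exact one_le_mul_of_one_le_of_one_le (Real.one_le_rpow hx ha.le) (Real.one_le_rpow hy hb.le)
  exact this.ordConnected

/-- Quantitative variance contraction: a centred density that is log-concave relative to the standard
Gaussian and vanishes on `(-∞, -T)` has variance at most `1 - c Pr[s < -T]`. -/
theorem exists_variance_contraction : ∃ c : ℝ, 0 < c ∧ ∀ (q : ℝ → ℝ) (T : ℝ), IsLogConcave q →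
    Integrable q (gaussianReal 0 1) → Integrable (fun s => s * q s) (gaussianReal 0 1) →
    Integrable (fun s => s ^ 2 * q s) (gaussianReal 0 1) → ∫ s, q s ∂(gaussianReal 0 1) = 1 →
    ∫ s, s * q s ∂(gaussianReal 0 1) = 0 → (∀ s < -T, q s = 0) →
    c * (gaussianReal 0 1).real (Set.Iio (-T)) ≤ ∫ s, (1 - s ^ 2) * q s ∂(gaussianReal 0 1) := by
  set γ := gaussianReal 0 1
  have g1 : 0 < γ.real (Set.Iio (-7)) := gaussianReal_real_pos isOpen_Iio ⟨-8, by norm_num⟩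
  have g2 : 0 < γ.real (Set.Ioi 1) := gaussianReal_real_pos isOpen_Ioi ⟨2, by norm_num⟩
  -- The three terms are the constants produced by the case analysis on `T`, `r` and `q 0` below.
  refine ⟨min (min (γ.real (Set.Iio (-7))) (1 / 2)) (1 / 2 * γ.real (Set.Ioi 1)), by positivity, ?_⟩
  intro q T hq i0 i1 i2 e0 e1 hT
  have le1 : ∀ S : Set ℝ, γ.real S ≤ 1 := fun S => measureReal_le_one
  have ic : Integrable (fun _ : ℝ => (1 : ℝ)) γ := integrable_const _
  have is : Integrable (fun s : ℝ => s) γ := integrable_id_gaussianReal'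
  have is2 : Integrable (fun s : ℝ => s ^ 2) γ := integrable_pow_gaussianReal 2
  -- The densities `q` and `1` have the same mass and mean, so only the quadratic coefficient sees
  -- their difference.
  have quad : ∀ A B C : ℝ, Integrable (fun s => (A + B * s + C * s ^ 2) * (q s - 1)) γ ∧
      ∫ s, (A + B * s + C * s ^ 2) * (q s - 1) ∂γ = C * (∫ s, s ^ 2 * q s ∂γ - 1) := by
    intro A B C
    have j : Integrable (fun s => A * q s + B * (s * q s) + C * (s ^ 2 * q s) -
        (A * 1 + B * s + C * s ^ 2)) γ :=
      (((i0.const_mul A).add (i1.const_mul B)).add (i2.const_mul C)).sub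
        (((ic.const_mul A).add (is.const_mul B)).add (is2.const_mul C))
    have e : (fun s => (A + B * s + C * s ^ 2) * (q s - 1)) = fun s =>
        A * q s + B * (s * q s) + C * (s ^ 2 * q s) - (A * 1 + B * s + C * s ^ 2) := by
      ext s; ring
    rw [e]
    refine ⟨j, ?_⟩
    have k1 : Integrable (fun s => A * q s + B * (s * q s)) γ :=
      (i0.const_mul A).add (i1.const_mul B)
    have k2 : Integrable (fun s => A * q s + B * (s * q s) + C * (s ^ 2 * q s)) γ :=
      k1.add (i2.const_mul C)
    have k3 : Integrable (fun s => A * 1 + B * s) γ := (ic.const_mul A).add (is.const_mul B)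
    have k4 : Integrable (fun s => A * 1 + B * s + C * s ^ 2) γ := k3.add (is2.const_mul C)
    rw [integral_sub k2 k4, integral_add k1 (i2.const_mul C),
      integral_add (i0.const_mul A) (i1.const_mul B), integral_add k3 (is2.const_mul C),
      integral_add (ic.const_mul A) (is.const_mul B)]
    have eB : ∫ s, B * s ∂γ = 0 :=
      (integral_const_mul B fun s : ℝ => s).trans (by rw [integral_id_gaussianReal', mul_zero])
    rw [eB]
    simp only [integral_const_mul]
    rw [e0, e1, integral_sq_gaussianReal]
    simp
    ring
  set S := {s | 1 ≤ q s}
  have hSc : S.OrdConnected := hq.ordConnected_superlevel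
  have hSn : S.Nonempty := by
    by_contra hne
    rw [Set.not_nonempty_iff_eq_empty] at hne
    have hlt : ∀ s, q s < 1 := fun s => by
      by_contra h
      have : s ∈ S := not_lt.1 h
      simp [hne] at this
    have z : ∫ s, (1 - q s) ∂γ = 0 := by rw [integral_sub ic i0, e0]; simp
    rw [integral_eq_zero_iff_of_nonneg (f := fun s => 1 - q s)
      (fun s => by simpa using (hlt s).le) (ic.sub i0)] at z
    have : ∀ᵐ s ∂γ, False := by
      filter_upwards [z] with s hs
      have := hlt s
      simp at hs; linarith
    simp at this
    exact NeZero.ne _ this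
  have hSb : ∀ s ∈ S, -T ≤ s := by
    intro s hs
    by_contra h
    have : q s = 0 := hT s (not_le.1 h)
    have h2 : 1 ≤ q s := hs
    linarith
  have bb : BddBelow S := ⟨-T, hSb⟩
  set l := sInf S
  have hl : -T ≤ l := le_csInf hSn hSb
  have lt_l : ∀ s < l, q s < 1 := fun s hs => not_le.1 fun h => (csInf_le bb h).not_gt hs
  -- If `{q ≥ 1}` were unbounded above, `(s - l) (q - 1)` would be nonnegative with integral zero,
  -- hence zero a.e. This fails on `(-∞, -T)`, where `q = 0`.
  have ba : BddAbove S := by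
    by_contra hba
    have hge : ∀ s, l < s → 1 ≤ q s := by
      intro s hs
      obtain ⟨x, hx, hxs⟩ := exists_lt_of_csInf_lt hSn hs
      obtain ⟨y, hy, hys⟩ := not_bddAbove_iff.1 hba s
      exact hSc.out hx hy ⟨hxs.le, hys.le⟩
    have hn : ∀ s, 0 ≤ (-l + 1 * s + 0 * s ^ 2) * (q s - 1) := by
      intro s
      rcases lt_trichotomy s l with h | h | h
      · have := lt_l s h; nlinarith
      · subst h; simp
      · have := hge s h; nlinarith
    have z := (quad (-l) 1 0).2
    rw [zero_mul, integral_eq_zero_iff_of_nonneg hn (quad _ _ _).1] at z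
    have : γ (Set.Iio (-T)) = 0 := by
      refine measure_mono_null ?_ z
      intro s (hs : s < -T) h
      have h : (-l + 1 * s + 0 * s ^ 2) * (q s - 1) = 0 := h
      rw [hT s hs] at h
      linarith
    have h2 := gaussianReal_real_pos (isOpen_Iio (a := -T)) ⟨-T - 1, by simp⟩
    simp [Measure.real, γ] at h2 this
    simp [this] at h2
  set r := sSup S
  have gt_r : ∀ s, r < s → q s < 1 := fun s hs => not_le.1 fun h => (le_csSup ba h).not_gt hs
  have mid : ∀ s, l < s → s < r → 1 ≤ q s := by
    intro s h1 h2
    obtain ⟨x, hx, hxs⟩ := exists_lt_of_csInf_lt hSn h1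
    obtain ⟨y, hy, hys⟩ := exists_lt_of_lt_csSup hSn h2
    exact hSc.out hx hy ⟨hxs.le, hys.le⟩
  have hlr : l ≤ r := csInf_le_csSup hSn bb ba
  -- The quadratic is `(s - l) (r - s)`, which changes sign exactly where `q - 1` does. So `D`, the
  -- variance deficit, is the integral of a nonnegative function and can be bounded below on any
  -- convenient set.
  set D := ∫ s, (-(l * r) + (l + r) * s + (-1) * s ^ 2) * (q s - 1) ∂γ with hD
  have Di := (quad (-(l * r)) (l + r) (-1)).1
  have D_eq : ∫ s, (1 - s ^ 2) * q s ∂γ = D := by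
    rw [hD, (quad _ _ _).2]
    have : (fun s => (1 - s ^ 2) * q s) = fun s => q s - s ^ 2 * q s := by ext; ring
    rw [this, integral_sub i0 i2, e0]; ring
  have pw : ∀ s, 0 ≤ (-(l * r) + (l + r) * s + (-1) * s ^ 2) * (q s - 1) := by
    intro s
    have e : -(l * r) + (l + r) * s + (-1) * s ^ 2 = (s - l) * (r - s) := by ring
    rw [e]
    rcases lt_or_ge s l with h | h
    · have := lt_l s h
      exact mul_nonneg_of_nonpos_of_nonpos (by nlinarith) (by linarith)
    rcases lt_or_ge r s with h' | h'
    · have := gt_r s h'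
      exact mul_nonneg_of_nonpos_of_nonpos (by nlinarith) (by linarith)
    rcases h.eq_or_lt with h | h
    · simp [h]
    rcases h'.eq_or_lt with h' | h'
    · simp [h']
    have := mid s h h'
    exact mul_nonneg (by nlinarith) (by linarith)
  have D_ge : ∀ (B : Set ℝ) (g : ℝ → ℝ), MeasurableSet B → Integrable g γ →
      (∀ s ∈ B, g s ≤ (-(l * r) + (l + r) * s + (-1) * s ^ 2) * (q s - 1)) →
      ∫ s in B, g s ∂γ ≤ D := by
    intro B g hB hg h
    refine (setIntegral_mono_on hg.integrableOn Di.integrableOn hB h).trans ?_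
    exact setIntegral_le_integral Di (ae_of_all _ pw)
  rw [D_eq]
  rcases le_or_gt T 6 with hT6 | hT6
  · have := D_ge (Set.Iio (-7)) (fun _ => 1) measurableSet_Iio ic (by
      intro s (hs : s < -7)
      rw [hT s (by linarith)]
      nlinarith)
    simp at this
    refine le_trans ?_ this
    calc _ ≤ γ.real (Set.Iio (-7)) * 1 := by
          gcongr
          · exact (min_le_left _ _).trans (min_le_left _ _)
          · exact le1 _
      _ = _ := mul_one _
  -- If `r ≥ -T / 2`, then on `s < -T` the integrand is at least `s (s + T) / 2`, whose integral
  -- there is half the tail.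
  rcases le_or_gt (-T / 2) r with hr | hr
  · have := D_ge (Set.Iio (-T)) (fun s => 1 / 2 * (s * (s + T))) measurableSet_Iio (by
      have := ((is2).add (is.mul_const T)).const_mul (1 / 2)
      refine this.congr (ae_of_all _ fun s => ?_)
      simp; ring) (by
      intro s (hs : s < -T)
      rw [hT s hs]
      have h1 : -T - s ≤ l - s := by linarith
      have h2 : -s / 2 ≤ r - s := by linarith
      have : (-T - s) * (-s / 2) ≤ (l - s) * (r - s) :=
        mul_le_mul h1 h2 (by linarith) (by linarith)
      linarith)
    rw [integral_const_mul, setIntegral_Iio_gaussianReal] at this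
    refine le_trans ?_ this
    gcongr
    exact (min_le_left _ _).trans (min_le_right _ _)
  -- the remaining case: the superlevel set lies far to the left
  have r0 : r < 0 := by linarith
  have hq0 : q 0 < 1 := gt_r 0 r0
  -- The point `0` lies between some `x < 0` with `q x ≥ 1` and `s`, so log-concavity forbids `q s >
  -- q 0`.
  have qpos : ∀ s, 0 < s → q s ≤ q 0 := by
    intro s hs
    obtain ⟨x, hx⟩ := hSn
    have hx0 : x < 0 := (le_csSup ba hx).trans_lt r0
    have h := hq.2 x s (s / (s - x)) (-x / (s - x)) (by apply div_pos <;> linarith)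
      (by apply div_pos <;> linarith) (by
        rw [← add_div, div_eq_one_iff_eq (by linarith)]; ring)
    have e : (s / (s - x)) • x + (-x / (s - x)) • s = 0 := by
      simp only [smul_eq_mul]; ring
    rw [e] at h
    have hs1 : q s ≤ 1 := (gt_r s (by linarith)).le
    rcases (hq.1 s).eq_or_lt with h0 | h0
    · rw [← h0]; exact hq.1 0
    calc q s = 1 * q s ^ (1 : ℝ) := by rw [Real.rpow_one, one_mul]
      _ ≤ q x ^ (s / (s - x)) * q s ^ (-x / (s - x)) := by
        refine mul_le_mul (Real.one_le_rpow hx (by apply div_nonneg <;> linarith)) ?_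
          (Real.rpow_nonneg h0.le _) (Real.rpow_nonneg (hq.1 x) _)
        refine Real.rpow_le_rpow_of_exponent_ge h0 hs1 ?_
        rw [div_le_one (by linarith)]; linarith
      _ ≤ _ := h
  rcases le_or_gt (q 0) (1 / 2) with hω | hω
  · have := D_ge (Set.Ioi 1) (fun _ => 1 / 2) measurableSet_Ioi (integrable_const _) (by
      intro s (hs : 1 < s)
      have h1 := qpos s (by linarith)
      have e : (-(l * r) + (l + r) * s + (-1) * s ^ 2) * (q s - 1) =
        ((s - l) * (s - r)) * (1 - q s) := by ring
      rw [e]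
      have : 1 ≤ (s - l) * (s - r) := by nlinarith
      nlinarith)
    simp at this
    refine le_trans ?_ this
    calc _ ≤ (1 / 2 * γ.real (Set.Ioi 1)) * 1 := by
          gcongr
          · exact min_le_right _ _
          · exact le1 _
      _ = _ := by ring
  exfalso
  set ω := 1 - q 0
  -- Write `ω = 1 - q 0 < 1/2`. For `s ∈ S` the midpoint `s / 2` lies to the right of `r`, so `q s *
  -- q 0 ≤ 1` and the excess is at most `2ω`, on a set of mass at most `1/9`. The deficit is at
  -- least `ω` on the positive half-line, of mass `1/2`. Hence `∫ (q - 1) < 0`, which is absurd.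
  have bound : ∀ s, q s - 1 ≤ (Set.Iio (-3 : ℝ)).indicator (fun _ => 2 * ω) s +
      (Set.Ioi (0 : ℝ)).indicator (fun _ => -ω) s := by
    intro s
    by_cases hs : s ∈ S
    · have hsr : s ≤ r := le_csSup ba hs
      have hsT := hSb s hs
      have h3 : s < -3 := by linarith
      have h0 : ¬ (0 < s) := by linarith
      simp only [Set.indicator, Set.mem_Iio, h3, Set.mem_Ioi, h0, if_true, if_false, add_zero]
      have h := hq.2 s 0 (1 / 2) (1 / 2) (by norm_num) (by norm_num) (by norm_num)
      have hm : q (s / 2) < 1 := gt_r _ (by linarith)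
      have e : ((1 / 2 : ℝ) • s + (1 / 2 : ℝ) • (0 : ℝ)) = s / 2 := by simp; ring
      rw [e, ← Real.sqrt_eq_rpow, ← Real.sqrt_eq_rpow, ← Real.sqrt_mul (hq.1 _)] at h
      have h4 : √(q s * q 0) ≤ 1 := h.trans hm.le
      rw [Real.sqrt_le_one] at h4
      simp only [ω]
      nlinarith
    · have hs : q s < 1 := not_le.1 hs
      have hω0 : 0 < ω := by simp only [ω]; linarith
      by_cases h0 : 0 < s
      · have h3 : ¬ (s < -3) := by linarith
        simp only [Set.indicator, Set.mem_Iio, h3, Set.mem_Ioi, h0, if_true, if_false, zero_add]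
        have := qpos s h0
        simp only [ω]; linarith
      · simp only [Set.indicator, Set.mem_Ioi, h0, if_false, add_zero]
        split_ifs <;> linarith
  have k1 : Integrable ((Set.Iio (-3 : ℝ)).indicator fun _ => 2 * ω) γ :=
    (integrable_const (2 * ω)).indicator measurableSet_Iio
  have k2 : Integrable ((Set.Ioi (0 : ℝ)).indicator fun _ => -ω) γ :=
    (integrable_const (-ω)).indicator measurableSet_Ioi
  have hint : ∫ s, (q s - 1) ∂γ ≤ ∫ s, ((Set.Iio (-3 : ℝ)).indicator (fun _ => 2 * ω) s +
      (Set.Ioi (0 : ℝ)).indicator (fun _ => -ω) s) ∂γ :=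
    integral_mono (i0.sub ic) (k1.add k2) bound
  rw [integral_sub i0 ic, e0, integral_add k1 k2,
    integral_indicator measurableSet_Iio, integral_indicator measurableSet_Ioi] at hint
  simp at hint
  rw [gaussianReal_real_Ioi_zero] at hint
  have h9 := gaussianReal_real_Iio_le (a := 3) (by norm_num)
  have hω0 : 0 < ω := by simp only [ω]; linarith
  have : γ.real (Set.Iio (-3)) ≤ 1 / 9 := by convert h9 using 1; norm_num
  nlinarith

theorem gaussianPDFReal_add_eq (s a : ℝ) :
    gaussianPDFReal 0 1 (s + a) = Real.exp (-a * s - a ^ 2 / 2) * gaussianPDFReal 0 1 s := by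
  rw [gaussianPDFReal_zero_one, gaussianPDFReal_zero_one, mul_left_comm, ← Real.exp_add]
  congr 2; ring

theorem integral_gaussianReal_shift (g : ℝ → ℝ) (a : ℝ) :
    ∫ s, g (s + a) * Real.exp (-a * s - a ^ 2 / 2) ∂(gaussianReal 0 1) =
      ∫ s, g s ∂(gaussianReal 0 1) := by
  rw [integral_gaussianReal_eq_integral_smul one_ne_zero,
    integral_gaussianReal_eq_integral_smul one_ne_zero,
    ← integral_add_right_eq_self (fun x => gaussianPDFReal 0 1 x • g x) a]
  congr 1; ext s
  rw [gaussianPDFReal_add_eq]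
  simp only [smul_eq_mul]; ring

theorem integrable_gaussianReal_shift {g : ℝ → ℝ} (hg : Integrable g (gaussianReal 0 1)) (a : ℝ) :
    Integrable (fun s => g (s + a) * Real.exp (-a * s - a ^ 2 / 2)) (gaussianReal 0 1) := by
  rw [integrable_gaussianReal_iff] at hg ⊢
  refine (hg.comp_add_right a).congr (ae_of_all _ fun s => ?_)
  simp only
  rw [gaussianPDFReal_add_eq]; ring

/-- Variance contraction for an uncentred and unnormalised log-concave weight. -/
theorem exists_variance_contraction' : ∃ c : ℝ, 0 < c ∧ ∀ (h : ℝ → ℝ) (T : ℝ), IsLogConcave h →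
    Measurable h → (∀ s, h s ≤ 1) → 0 < ∫ s, h s ∂(gaussianReal 0 1) → (∀ s < -T, h s = 0) →
    c * (∫ s, h s ∂(gaussianReal 0 1)) * (gaussianReal 0 1).real
      (Set.Iio (-(T + (∫ s, s * h s ∂(gaussianReal 0 1)) / ∫ s, h s ∂(gaussianReal 0 1)))) ≤
    ∫ s, (1 - s ^ 2 + ((∫ s, s * h s ∂(gaussianReal 0 1)) / ∫ s, h s ∂(gaussianReal 0 1)) * s) * h s
      ∂(gaussianReal 0 1) := by
  obtain ⟨c, hc, H⟩ := exists_variance_contraction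
  refine ⟨c, hc, fun h T hl hm h1 hpos hT => ?_⟩
  set γ := gaussianReal 0 1
  set β := ∫ s, h s ∂γ with hβ
  set m := ∫ s, s * h s ∂γ with hmm
  set a := m / β with ha
  have haβ : a * β = m := by rw [ha]; field_simp
  have j0 : Integrable h γ := by
    simpa using integrable_mul_of_le_one (integrable_const (1 : ℝ)) hm.aestronglyMeasurable hl.1 h1
  have j1 : Integrable (fun s => s * h s) γ :=
    integrable_mul_of_le_one integrable_id_gaussianReal' hm.aestronglyMeasurable hl.1 h1
  have j2 : Integrable (fun s => s ^ 2 * h s) γ :=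
    integrable_mul_of_le_one (integrable_pow_gaussianReal 2) hm.aestronglyMeasurable hl.1 h1
  have lin : ∀ A B C : ℝ, Integrable (fun s => (A + B * s + C * s ^ 2) * h s) γ ∧
      ∫ s, (A + B * s + C * s ^ 2) * h s ∂γ = A * β + B * m + C * ∫ s, s ^ 2 * h s ∂γ := by
    intro A B C
    have k1 : Integrable (fun s => A * h s + B * (s * h s)) γ := (j0.const_mul A).add (j1.const_mul B)
    have e : (fun s => (A + B * s + C * s ^ 2) * h s) = fun s =>
        A * h s + B * (s * h s) + C * (s ^ 2 * h s) := by ext s; ring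
    rw [e]
    refine ⟨k1.add (j2.const_mul C), ?_⟩
    rw [integral_add k1 (j2.const_mul C), integral_add (j0.const_mul A) (j1.const_mul B)]
    simp only [integral_const_mul]
    rw [hβ, hmm]
  -- Translating by the mean `a` and tilting by the Cameron–Martin factor gives a normalised centred
  -- density. The tilt is log-affine, so log-concavity survives, and the support bound moves from
  -- `-T` to `-(T + a)`.
  set q : ℝ → ℝ := fun s => β⁻¹ * (h (s + a) * Real.exp (-a * s - a ^ 2 / 2)) with hq
  have key : ∀ A B C : ℝ, Integrable (fun s => (A + B * s + C * s ^ 2) * q s) γ ∧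
      ∫ s, (A + B * s + C * s ^ 2) * q s ∂γ = β⁻¹ * ((A - B * a + C * a ^ 2) * β +
        (B - 2 * C * a) * m + C * ∫ s, s ^ 2 * h s ∂γ) := by
    intro A B C
    have l := lin (A - B * a + C * a ^ 2) (B - 2 * C * a) C
    have e : (fun s => (A + B * s + C * s ^ 2) * q s) = fun s => β⁻¹ *
        ((((A - B * a + C * a ^ 2) + (B - 2 * C * a) * (s + a) + C * (s + a) ^ 2) * h (s + a)) *
          Real.exp (-a * s - a ^ 2 / 2)) := by ext s; simp only [hq]; ring
    rw [e]
    refine ⟨(integrable_gaussianReal_shift l.1 a).const_mul _, ?_⟩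
    rw [integral_const_mul, integral_gaussianReal_shift
      (fun t => ((A - B * a + C * a ^ 2) + (B - 2 * C * a) * t + C * t ^ 2) * h t), l.2]
  have hql : IsLogConcave q := by
    have l1 : IsLogConcave fun s : ℝ => h (s + a) := hl.comp_affine fun x y s t hst => by
      simp only [smul_eq_mul]; linear_combination (-a) * hst
    have l2 : IsLogConcave fun s : ℝ => Real.exp (-a * s - a ^ 2 / 2 - Real.log β) := by
      refine isLogConcave_exp_of_concave ⟨convex_univ, fun x _ y _ s t hs ht hst => ?_⟩
      simp only [smul_eq_mul]
      apply le_of_eq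
      linear_combination (- a ^ 2 / 2 - Real.log β) * hst
    have := l1.mul l2
    convert this using 2 with s
    rw [Real.exp_sub _ (Real.log β), Real.exp_log hpos]
    simp only [hq]; ring
  have z := H q (T + a) hql (by simpa using (key 1 0 0).1) (by simpa using (key 0 1 0).1)
    (by simpa using (key 0 0 1).1)
    (by have := (key 1 0 0).2; simp at this; rw [this]; field_simp)
    (by have := (key 0 1 0).2; simp at this; rw [this, haβ]; simp)
    (fun s hs => by simp only [hq]; rw [hT _ (by linarith)]; ring)
  have e1 : ∫ s, (1 - s ^ 2) * q s ∂γ = β⁻¹ * (β + a * m - ∫ s, s ^ 2 * h s ∂γ) := by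
    have := (key 1 0 (-1)).2
    have e : (fun s => (1 - s ^ 2) * q s) = fun s => (1 + 0 * s + (-1) * s ^ 2) * q s := by
      ext; ring
    rw [e, this]
    linear_combination (-a * β⁻¹) * haβ
  have e2 : ∫ s, (1 - s ^ 2 + a * s) * h s ∂γ = β + a * m - ∫ s, s ^ 2 * h s ∂γ := by
    have := (lin 1 a (-1)).2
    have e : (fun s => (1 - s ^ 2 + a * s) * h s) = fun s => (1 + a * s + (-1) * s ^ 2) * h s := by
      ext; ring
    rw [e, this]; ring
  rw [e2]
  rw [e1] at z
  rw [inv_mul_eq_div, le_div_iff₀ hpos] at z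
  linarith

/-! ### Gaussian tails under shifts. -/

theorem gaussianReal_real_Iio_add (T a : ℝ) : (gaussianReal 0 1).real (Set.Iio (-(T + a))) =
    ∫ s in Set.Iio (-T), Real.exp (a * s - a ^ 2 / 2) ∂(gaussianReal 0 1) := by
  have := integral_gaussianReal_shift ((Set.Iio (-(T + a))).indicator fun _ => 1) (-a)
  rw [integral_indicator measurableSet_Iio] at this
  rw [setIntegral_one_eq_measureReal] at this
  rw [← integral_indicator measurableSet_Iio, ← this]
  congr 1; ext s
  have e' : s + -a < -(T + a) ↔ s < -T := by constructor <;> intro h <;> linarith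
  by_cases hs : s < -T
  · simp only [Set.indicator, Set.mem_Iio, e', hs]; simp
  · simp only [Set.indicator, Set.mem_Iio, e', hs]; simp

theorem integrable_exp_mul_gaussianReal' (a b : ℝ) :
    Integrable (fun s => Real.exp (a * s - b)) (gaussianReal 0 1) := by
  have := (integrable_exp_mul_gaussianReal (μ := 0) (v := 1) a).mul_const (Real.exp (-b))
  refine this.congr (ae_of_all _ fun s => ?_)
  simp only
  rw [← Real.exp_add, sub_eq_add_neg]

theorem gaussianReal_real_Iio_le_exp {T : ℝ} (hT : 0 ≤ T) :
    (gaussianReal 0 1).real (Set.Iio (-T)) ≤ Real.exp (-T ^ 2 / 2) := by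
  have := gaussianReal_real_Iio_add 0 T
  rw [zero_add, neg_zero] at this
  rw [this]
  calc _ ≤ ∫ s in Set.Iio (0 : ℝ), Real.exp (-T ^ 2 / 2) ∂(gaussianReal 0 1) := by
        refine setIntegral_mono_on (integrable_exp_mul_gaussianReal' _ _).integrableOn
          (integrable_const _).integrableOn measurableSet_Iio fun s (hs : s < 0) => ?_
        rw [Real.exp_le_exp]; nlinarith
    _ ≤ _ := by
        simp only [setIntegral_const, smul_eq_mul]
        exact mul_le_of_le_one_left (Real.exp_pos _).le measureReal_le_one

/-- The shifted tail is an exponentially weighted integral over the original one. The unit window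
`[-T - 1, -T)` carries at least the fraction `1 - exp (-1/2)` of the tail, and there the weight is
bounded below by its value at the left end. -/
theorem gaussianReal_real_Iio_add_ge {T a : ℝ} (hT : 0 ≤ T) (ha : 0 ≤ a) :
    (1 - Real.exp (-1 / 2)) * Real.exp (-a * (T + 1) - a ^ 2 / 2) *
      (gaussianReal 0 1).real (Set.Iio (-T)) ≤ (gaussianReal 0 1).real (Set.Iio (-(T + a))) := by
  set γ := gaussianReal 0 1
  have h1 : γ.real (Set.Iio (-(T + 1))) ≤ Real.exp (-1 / 2) * γ.real (Set.Iio (-T)) := by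
    rw [gaussianReal_real_Iio_add]
    calc _ ≤ ∫ s in Set.Iio (-T), Real.exp (-1 / 2) ∂γ := by
          refine setIntegral_mono_on (integrable_exp_mul_gaussianReal' _ _).integrableOn
            (integrable_const _).integrableOn measurableSet_Iio fun s (hs : s < -T) => ?_
          rw [Real.exp_le_exp]; linarith
      _ = _ := by simp only [setIntegral_const, smul_eq_mul]; ring
  have h2 : γ.real (Set.Ico (-(T + 1)) (-T)) =
      γ.real (Set.Iio (-T)) - γ.real (Set.Iio (-(T + 1))) := by
    rw [← measureReal_sdiff (Set.Iio_subset_Iio (by linarith)) measurableSet_Iio]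
    congr 1; ext s; simp [and_comm]
  rw [gaussianReal_real_Iio_add T a]
  calc _ = Real.exp (-a * (T + 1) - a ^ 2 / 2) *
          (γ.real (Set.Iio (-T)) - Real.exp (-1 / 2) * γ.real (Set.Iio (-T))) := by ring
    _ ≤ Real.exp (-a * (T + 1) - a ^ 2 / 2) * γ.real (Set.Ico (-(T + 1)) (-T)) := by
        rw [h2]; gcongr
    _ = ∫ s in Set.Ico (-(T + 1)) (-T), Real.exp (-a * (T + 1) - a ^ 2 / 2) ∂γ := by
        simp only [setIntegral_const, smul_eq_mul]; ring
    _ ≤ ∫ s in Set.Ico (-(T + 1)) (-T), Real.exp (a * s - a ^ 2 / 2) ∂γ := by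
        refine setIntegral_mono_on (integrable_const _).integrableOn
          (integrable_exp_mul_gaussianReal' _ _).integrableOn measurableSet_Ico fun s hs => ?_
        rw [Real.exp_le_exp]
        have := hs.1
        nlinarith
    _ ≤ _ := setIntegral_mono_set (integrable_exp_mul_gaussianReal' _ _).integrableOn
        (ae_of_all _ fun s => (Real.exp_pos _).le)
        (LE.le.eventuallyLE fun s hs => hs.2)

/-- Gaussian tails at a level of mass at least `z` are stable under shifts of size
`1 / √(log (1 / z + 1))`. -/
theorem exists_tail_shift : ∃ c : ℝ, 0 < c ∧ ∀ T a z : ℝ, 0 < z → z ≤ 1 →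
    z ≤ (gaussianReal 0 1).real (Set.Iio (-T)) → |a| ≤ 1 / √(Real.log (1 / z + 1)) →
    c * (gaussianReal 0 1).real (Set.Iio (-T)) ≤ (gaussianReal 0 1).real (Set.Iio (-(T + a))) := by
  set γ := gaussianReal 0 1
  have g2 : 0 < γ.real (Set.Iio (-2)) := gaussianReal_real_pos isOpen_Iio ⟨-3, by norm_num⟩
  have he : Real.exp (-1 / 2) < 1 := by rw [Real.exp_lt_one_iff]; norm_num
  have hp : 0 < (1 - Real.exp (-1 / 2)) * Real.exp (-6) :=
    mul_pos (by linarith) (Real.exp_pos _)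
  -- The `6` bounds `a (T + 1) + a² / 2`, using `a T ≤ 2` and `a ≤ 2`. The term `γ (-∞, -2)` handles
  -- `T < 0`, and `1` handles `a ≤ 0`.
  refine ⟨min (min (γ.real (Set.Iio (-2))) 1) ((1 - Real.exp (-1 / 2)) * Real.exp (-6)),
    lt_min (lt_min g2 one_pos) hp, ?_⟩
  intro T a z hz hz1 hzT ha
  set L := Real.log (1 / z + 1) with hL
  have hz' : 1 ≤ 1 / z := by rw [le_div_iff₀ hz]; linarith
  have hL4 : 1 / 4 ≤ L := by
    have h2 : Real.log 2 ≤ L := Real.log_le_log (by norm_num) (by linarith)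
    have := Real.log_two_gt_d9
    linarith
  have hsL : 1 / 2 ≤ √L := by
    rw [Real.le_sqrt (by norm_num) (by linarith)]; linarith
  have hsp : 0 < √L := by linarith
  have ha2 : |a| ≤ 2 := ha.trans (by rw [div_le_iff₀ hsp]; linarith)
  have n0 : 0 ≤ γ.real (Set.Iio (-T)) := measureReal_nonneg
  have n1 : γ.real (Set.Iio (-T)) ≤ 1 := measureReal_le_one
  rcases le_or_gt a 0 with h | h
  · calc _ ≤ 1 * γ.real (Set.Iio (-T)) := by
          gcongr; exact (min_le_left _ _).trans (min_le_right _ _)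
      _ ≤ _ := by
          rw [one_mul]
          exact measureReal_mono (Set.Iio_subset_Iio (by linarith))
  rw [abs_of_pos h] at ha ha2
  rcases lt_or_ge T 0 with hT | hT
  · calc _ ≤ γ.real (Set.Iio (-2)) * 1 := by
          gcongr; exact (min_le_left _ _).trans (min_le_left _ _)
      _ ≤ _ := by
          rw [mul_one]
          exact measureReal_mono (Set.Iio_subset_Iio (by linarith))
  -- A tail of mass at least `z` cannot start farther out than `√(2 log (1 / z))`.
  have hT2 : T ^ 2 ≤ 2 * L := by
    have h1 := hzT.trans (gaussianReal_real_Iio_le_exp hT)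
    have h3 : Real.log z ≤ -T ^ 2 / 2 := by
      rw [← Real.log_exp (-T ^ 2 / 2)]; exact Real.log_le_log hz h1
    have h4 : Real.log (1 / z) ≤ L := Real.log_le_log (by positivity) (by linarith)
    rw [one_div, Real.log_inv] at h4
    linarith
  have haT : a * T ≤ 2 := by
    have h5 : T ≤ 2 * √L := by
      apply le_of_sq_le_sq _ (by positivity)
      rw [mul_pow, Real.sq_sqrt (by linarith)]; linarith
    calc a * T ≤ 1 / √L * (2 * √L) := mul_le_mul ha h5 hT (by positivity)
      _ = 2 := by field_simp
  refine le_trans ?_ (gaussianReal_real_Iio_add_ge hT h.le)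
  gcongr
  refine (min_le_right _ _).trans ?_
  gcongr
  nlinarith

/-! ### Slicing the standard Gaussian along a direction; convex bodies. -/

section StdGaussian

variable {E : Type} [NormedAddCommGroup E] [InnerProductSpace ℝ E] [FiniteDimensional ℝ E]
  [MeasurableSpace E] [BorelSpace E]

theorem stdGaussian_map_inner {e : E} (he : ‖e‖ = 1) :
    (stdGaussian E).map (fun x => ⟪e, x⟫_ℝ) = gaussianReal 0 1 := by
  have := IsGaussian.map_eq_gaussianReal (μ := stdGaussian E) (innerSL ℝ e)
  rw [variance_dual_stdGaussian, innerSL_apply_norm, he, integral_strongDual_stdGaussian] at this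
  simpa using! this

/-- Jointly Gaussian variables are independent once uncorrelated. The hypothesis says that the
adjoint images of `L₁` and `L₂` are orthogonal. -/
theorem indepFun_stdGaussian {F₁ F₂ : Type} [NormedAddCommGroup F₁] [InnerProductSpace ℝ F₁]
    [FiniteDimensional ℝ F₁] [MeasurableSpace F₁] [BorelSpace F₁] [NormedAddCommGroup F₂]
    [InnerProductSpace ℝ F₂] [FiniteDimensional ℝ F₂] [MeasurableSpace F₂] [BorelSpace F₂]
    (L₁ : E →L[ℝ] F₁) (L₂ : E →L[ℝ] F₂)
    (h : ∀ a b, ∃ u v : E, (∀ x, ⟪a, L₁ x⟫_ℝ = ⟪u, x⟫_ℝ) ∧ (∀ x, ⟪b, L₂ x⟫_ℝ = ⟪v, x⟫_ℝ) ∧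
      ⟪u, v⟫_ℝ = 0) :
    IndepFun L₁ L₂ (stdGaussian E) := by
  have hg : HasGaussianLaw (fun x => (L₁ x, L₂ x)) (stdGaussian E) :=
    ⟨by
      have : IsGaussian ((stdGaussian E).map (L₁.prod L₂)) := inferInstance
      exact this⟩
  refine hg.indepFun_of_covariance_inner fun a b => ?_
  obtain ⟨u, v, hu, hv, huv⟩ := h a b
  simp only [hu, hv]
  rw [← covarianceBilin_apply_eq_cov IsGaussian.memLp_two_id, covarianceBilin_stdGaussian]
  simpa using! huv

theorem map_prod_stdGaussian {e : E} (he : ‖e‖ = 1) :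
    (stdGaussian E).map (fun x => (⟪e, x⟫_ℝ, x - ⟪e, x⟫_ℝ • e)) =
      (gaussianReal 0 1).prod ((stdGaussian E).map fun x => x - ⟪e, x⟫_ℝ • e) := by
  have hi := indepFun_stdGaussian (E := E) (innerSL ℝ e)
    (ContinuousLinearMap.id ℝ E - (innerSL ℝ e).smulRight e) (fun a b => by
      refine ⟨a • e, b - ⟪e, b⟫_ℝ • e, fun x => ?_, fun x => ?_, ?_⟩
      · simp [inner_smul_left, mul_comm]
      · simp [inner_sub_left, inner_sub_right, inner_smul_left, inner_smul_right,
          real_inner_comm e b, mul_comm]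
      · simp [inner_sub_right, inner_smul_left, inner_smul_right, he,
          mul_comm])
  have := (indepFun_iff_map_prod_eq_prod_map_map (by fun_prop) (by fun_prop)).1 hi
  rw [← stdGaussian_map_inner he]
  simpa using! this

theorem integral_stdGaussian_fiber {e : E} (he : ‖e‖ = 1) {ψ : ℝ → ℝ} (hψ : Measurable ψ)
    {G : E → ℝ} (hG : Measurable G) (hi : Integrable (fun x => ψ ⟪e, x⟫_ℝ * G x) (stdGaussian E)) :
    ∫ x, ψ ⟪e, x⟫_ℝ * G x ∂(stdGaussian E) =
      ∫ s, ψ s * (∫ x, G (s • e + (x - ⟪e, x⟫_ℝ • e)) ∂(stdGaussian E)) ∂(gaussianReal 0 1) := by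
  have hm : Measurable fun x : E => (⟪e, x⟫_ℝ, x - ⟪e, x⟫_ℝ • e) := by fun_prop
  have hH : Measurable fun p : ℝ × E => ψ p.1 * G (p.1 • e + p.2) := by fun_prop
  have e1 : (fun x => ψ ⟪e, x⟫_ℝ * G x) =
      fun x => (fun p : ℝ × E => ψ p.1 * G (p.1 • e + p.2)) (⟪e, x⟫_ℝ, x - ⟪e, x⟫_ℝ • e) := by
    ext x; simp
  rw [e1] at hi ⊢
  rw [← integral_map (φ := fun x => (⟪e, x⟫_ℝ, x - ⟪e, x⟫_ℝ • e)) hm.aemeasurable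
    hH.aestronglyMeasurable, map_prod_stdGaussian he, integral_prod]
  · congr 1; ext s
    simp only
    rw [integral_const_mul, integral_map (f := fun y => G (s • e + y))
      (Measurable.aemeasurable (by fun_prop))
      (hG.comp (measurable_const_add (s • e))).aestronglyMeasurable]
  · rw [← map_prod_stdGaussian he]
    exact (integrable_map_measure hH.aestronglyMeasurable hm.aemeasurable).2 hi

theorem integrable_comp_inner_stdGaussian {e : E} (he : ‖e‖ = 1) {ψ : ℝ → ℝ}
    (hψ : Integrable ψ (gaussianReal 0 1)) :
    Integrable (fun x => ψ ⟪e, x⟫_ℝ) (stdGaussian E) := by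
  rw [← stdGaussian_map_inner he] at hψ
  exact hψ.comp_measurable (by fun_prop)

theorem integral_comp_inner_stdGaussian {e : E} (he : ‖e‖ = 1) {ψ : ℝ → ℝ} (hψ : Measurable ψ) :
    ∫ x, ψ ⟪e, x⟫_ℝ ∂(stdGaussian E) = ∫ s, ψ s ∂(gaussianReal 0 1) := by
  rw [← stdGaussian_map_inner he, integral_map (by fun_prop) hψ.aestronglyMeasurable]

/-- In coordinates this is a Gaussian marginal of the indicator of a convex set composed with an
affine map, so Prékopa's theorem applies. -/
theorem isLogConcave_fiber (e : E) {A : Set E} (hA : Convex ℝ A) (hm : MeasurableSet A) :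
    IsLogConcave fun s : ℝ => ∫ x, A.indicator (fun _ => (1 : ℝ)) (s • e + (x - ⟪e, x⟫_ℝ • e))
      ∂(stdGaussian E) := by
  have hI : Measurable (A.indicator fun _ => (1 : ℝ)) := measurable_const.indicator hm
  have eq : ∀ s : ℝ, ∫ x, A.indicator (fun _ => (1 : ℝ)) (s • e + (x - ⟪e, x⟫_ℝ • e))
      ∂(stdGaussian E) = ∫ y, A.indicator (fun _ => (1 : ℝ)) (s • e +
        ((∑ i, y i • stdOrthonormalBasis ℝ E i) -
          ⟪e, ∑ i, y i • stdOrthonormalBasis ℝ E i⟫_ℝ • e))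
        ∂(Measure.pi fun _ => gaussianReal 0 1) := by
    intro s
    rw [stdGaussian, integral_map (Measurable.aemeasurable (by fun_prop))]
    exact (hI.comp (by fun_prop)).aestronglyMeasurable
  simp only [eq]
  refine IsLogConcave.integral_pi_gaussianReal _ (E := ℝ)
    (F := fun z => A.indicator (fun _ => (1 : ℝ)) (z.1 • e +
        ((∑ i, z.2 i • stdOrthonormalBasis ℝ E i) -
          ⟪e, ∑ i, z.2 i • stdOrthonormalBasis ℝ E i⟫_ℝ • e)))
    ((isLogConcave_indicator hA).comp_affine ?_) ?_ ?_
  · intro x y a b _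
    simp only [Prod.fst_add, Prod.snd_add, Prod.smul_fst, Prod.smul_snd, Pi.add_apply,
      Pi.smul_apply, add_smul, Finset.sum_add_distrib, smul_eq_mul, mul_smul, ← Finset.smul_sum,
      inner_add_right, inner_smul_right, smul_add, smul_sub]
    module
  · intro z
    exact Set.indicator_le_self' (fun _ _ => zero_le_one) _ |>.trans (by simp) |>.trans le_rfl
  · intro s
    exact hI.comp (by fun_prop)

/-- Variance contraction for a convex body contained in a halfspace. -/
theorem exists_convex_contraction : ∃ c : ℝ, 0 < c ∧ ∀ (d : ℕ) (A : Set (RSpace d)) (e : RSpace d)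
    (T : ℝ), Convex ℝ A → MeasurableSet A → ‖e‖ = 1 → (∀ x ∈ A, -T ≤ ⟪e, x⟫_ℝ) →
    0 < (stdGaussian (RSpace d)).real A →
    c * (stdGaussian (RSpace d)).real A * (gaussianReal 0 1).real (Set.Iio (-(T +
      (∫ x in A, ⟪e, x⟫_ℝ ∂(stdGaussian (RSpace d))) / (stdGaussian (RSpace d)).real A))) ≤
    ∫ x in A, (1 - ⟪e, x⟫_ℝ ^ 2 + ((∫ x in A, ⟪e, x⟫_ℝ ∂(stdGaussian (RSpace d))) /
      (stdGaussian (RSpace d)).real A) * ⟪e, x⟫_ℝ) ∂(stdGaussian (RSpace d)) := by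
  obtain ⟨c, hc, H⟩ := exists_variance_contraction'
  refine ⟨c, hc, fun d A e T hA hm he hT hpos => ?_⟩
  set γ := stdGaussian (RSpace d)
  have hI : Measurable (A.indicator fun _ => (1 : ℝ)) := measurable_const.indicator hm
  have I0 : ∀ x, 0 ≤ A.indicator (fun _ => (1 : ℝ)) x := fun x =>
    Set.indicator_nonneg (fun _ _ => zero_le_one) _
  have I1 : ∀ x, A.indicator (fun _ => (1 : ℝ)) x ≤ 1 := fun x =>
    Set.indicator_le' (fun _ _ => le_rfl) (fun _ _ => zero_le_one) _
  set h : ℝ → ℝ := fun s => ∫ x, A.indicator (fun _ => (1 : ℝ)) (s • e + (x - ⟪e, x⟫_ℝ • e)) ∂γ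
  have fib : ∀ ψ : ℝ → ℝ, Measurable ψ → Integrable ψ (gaussianReal 0 1) →
      ∫ x in A, ψ ⟪e, x⟫_ℝ ∂γ = ∫ s, ψ s * h s ∂(gaussianReal 0 1) := by
    intro ψ hψ hψi
    have hii := integrable_mul_of_le_one (integrable_comp_inner_stdGaussian he hψi)
      hI.aestronglyMeasurable I0 I1
    rw [← integral_stdGaussian_fiber he hψ hI hii, ← integral_indicator hm]
    congr 1; ext x
    by_cases hx : x ∈ A <;> simp [hx]
  have hlc : IsLogConcave h := isLogConcave_fiber e hA hm
  have hmeas : Measurable h := by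
    refine (StronglyMeasurable.integral_prod_right (ν := γ)
      (f := fun (s : ℝ) (x : RSpace d) => A.indicator (fun _ => (1 : ℝ))
        (s • e + (x - ⟪e, x⟫_ℝ • e))) ?_).measurable
    exact (hI.comp (by fun_prop)).stronglyMeasurable
  have h1 : ∀ s, h s ≤ 1 := by
    intro s
    refine (integral_mono_of_nonneg (ae_of_all _ fun x => I0 _) (integrable_const (1 : ℝ))
      (ae_of_all _ fun x => I1 _)).trans ?_
    simp
  have f0 := fib (fun _ => 1) measurable_const (integrable_const 1)
  have f1 := fib (fun s => s) measurable_id integrable_id_gaussianReal'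
  simp only [setIntegral_one_eq_measureReal, one_mul] at f0
  have z := H h T hlc hmeas h1 (by rw [← f0]; exact hpos) (by
    intro s hs
    refine integral_eq_zero_of_ae (ae_of_all _ fun x => ?_)
    apply Set.indicator_of_notMem
    intro hx
    have := hT _ hx
    rw [inner_add_right, inner_sub_right, inner_smul_right, inner_smul_right,
      real_inner_self_eq_norm_sq, he] at this
    linarith)
  rw [← f0, ← f1] at z
  refine z.trans_eq ?_
  set a := (∫ x in A, ⟪e, x⟫_ℝ ∂γ) / γ.real A
  exact (fib (fun s => 1 - s ^ 2 + a * s) (by fun_prop)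
    (((integrable_const 1).sub (integrable_pow_gaussianReal 2)).add
      (integrable_id_gaussianReal'.const_mul a))).symm

end StdGaussian

/-- An intersection of `K` halfspaces misses some facet with probability at least `(1 - β) / K`. -/
theorem exists_facet {d K : ℕ} (hK : 0 < K) (a : Fin K → RSpace d) (b : Fin K → ℝ)
    (h0 : 0 < (stdGaussian (RSpace d)).real {x | ∀ i, 0 ≤ ⟪a i, x⟫_ℝ + b i})
    (h1 : (stdGaussian (RSpace d)).real {x | ∀ i, 0 ≤ ⟪a i, x⟫_ℝ + b i} < 1) :
    ∃ i, a i ≠ 0 ∧ (1 - (stdGaussian (RSpace d)).real {x | ∀ i, 0 ≤ ⟪a i, x⟫_ℝ + b i}) / K ≤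
      (gaussianReal 0 1).real (Set.Iio (-(b i / ‖a i‖))) := by
  set γ := stdGaussian (RSpace d)
  set A := {x : RSpace d | ∀ i, 0 ≤ ⟪a i, x⟫_ℝ + b i} with hA
  have hm : ∀ i, MeasurableSet {x : RSpace d | ⟪a i, x⟫_ℝ + b i < 0} := fun i =>
    measurableSet_lt (by fun_prop) measurable_const
  have hAm : MeasurableSet A := by
    rw [hA, Set.ofPred_forall]
    exact MeasurableSet.iInter fun i => measurableSet_le measurable_const (by fun_prop)
  have hc : Aᶜ = ⋃ i, {x : RSpace d | ⟪a i, x⟫_ℝ + b i < 0} := by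
    ext x; simp [hA]
  have hsum : 1 - γ.real A ≤ ∑ i, γ.real {x : RSpace d | ⟪a i, x⟫_ℝ + b i < 0} := by
    rw [← probReal_compl_eq_one_sub hAm, hc]
    exact measureReal_iUnion_fintype_le _
  have hKp : (0 : ℝ) < K := by exact_mod_cast hK
  obtain ⟨i, -, hi⟩ := Finset.exists_le_of_sum_le (s := Finset.univ) (f := fun _ : Fin K => (1 - γ.real A) / K)
    (g := fun i => γ.real {x : RSpace d | ⟪a i, x⟫_ℝ + b i < 0})
    ⟨⟨0, hK⟩, Finset.mem_univ _⟩ (by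
      refine le_trans (le_of_eq ?_) hsum
      simp; field_simp)
  have hpos : 0 < (1 - γ.real A) / K := div_pos (by linarith) hKp
  -- A zero normal makes the set empty or gives a constraint that never fails. Both contradict the
  -- mass assumptions.
  have hai : a i ≠ 0 := by
    intro h
    rcases lt_or_ge (b i) 0 with hb | hb
    · have : A = ∅ := by
        ext x; simp only [hA, Set.mem_ofPred_eq, Set.mem_empty_iff_false, iff_false]
        intro hx
        have := hx i
        rw [h, inner_zero_left] at this
        linarith
      rw [this] at h0
      simp at h0
    · have : {x : RSpace d | ⟪a i, x⟫_ℝ + b i < 0} = ∅ := by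
        ext x; simp [h, hb]
      rw [this] at hi
      simp at hi
      linarith
  refine ⟨i, hai, hi.trans (le_of_eq ?_)⟩
  have hn : 0 < ‖a i‖ := norm_pos_iff.2 hai
  have he : ‖(‖a i‖⁻¹ • a i)‖ = 1 := by
    rw [norm_smul, norm_inv, norm_norm]; field_simp
  rw [← stdGaussian_map_inner he, map_measureReal_apply (by fun_prop) measurableSet_Iio]
  congr 1; ext x
  simp only [Set.mem_ofPred_eq, Set.mem_preimage, Set.mem_Iio, inner_smul_left]
  rw [← neg_div, lt_div_iff₀ hn]
  have : (starRingEnd ℝ) ‖a i‖⁻¹ * ⟪a i, x⟫_ℝ * ‖a i‖ = ⟪a i, x⟫_ℝ := by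
    simp; field_simp
  rw [this]
  constructor <;> intro h <;> linarith

/-! ### Nazarov's surface-area bound for polyhedra. -/

theorem stdGaussian_eq_lintegral_lines {E : Type} [NormedAddCommGroup E] [InnerProductSpace ℝ E]
    [FiniteDimensional ℝ E] [MeasurableSpace E] [BorelSpace E] {e : E} (he : ‖e‖ = 1) {B : Set E}
    (hB : MeasurableSet B) :
    stdGaussian E B = ∫⁻ y, gaussianReal 0 1 {s | s • e + y ∈ B}
      ∂((stdGaussian E).map fun x => x - ⟪e, x⟫_ℝ • e) := by
  have hm : Measurable fun p : ℝ × E => p.1 • e + p.2 := by fun_prop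
  have h2 : Measurable fun x : E => (⟪e, x⟫_ℝ, x - ⟪e, x⟫_ℝ • e) := by fun_prop
  have := Measure.prod_apply_symm (μ := gaussianReal 0 1)
    (ν := (stdGaussian E).map fun x => x - ⟪e, x⟫_ℝ • e) (hm hB)
  rw [← map_prod_stdGaussian he, Measure.map_apply h2 (hm hB)] at this
  have e : (fun x => (⟪e, x⟫_ℝ, x - ⟪e, x⟫_ℝ • e)) ⁻¹' ((fun p : ℝ × E => p.1 • e + p.2) ⁻¹' B) = B := by
    ext x; simp
  rw [e] at this
  exact this

theorem gaussianReal_Icc_le {b δ M : ℝ} (hδ : 0 ≤ δ)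
    (hM : ∀ s ∈ Set.Icc b (b + δ), gaussianPDFReal 0 1 s ≤ M) :
    gaussianReal 0 1 (Set.Icc b (b + δ)) ≤ ENNReal.ofReal (δ * M) := by
  rw [gaussianReal_apply _ one_ne_zero]
  calc _ ≤ ∫⁻ _ in Set.Icc b (b + δ), ENNReal.ofReal M := by
        refine setLIntegral_mono' measurableSet_Icc fun s hs => ?_
        exact ENNReal.ofReal_le_ofReal (hM s hs)
    _ = _ := by
        rw [setLIntegral_const, Real.volume_Icc, mul_comm, ← ENNReal.ofReal_mul (by linarith)]
        congr 2; ring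

/-- Far facets: the whole strip stays beyond `3H/2` from the origin, where the density is below `exp
(-H²)`. -/
theorem gaussianReal_Icc_le_of_tail {b δ H : ℝ} (hδ : 0 ≤ δ) (hδ2 : δ ≤ H / 2)
    (hb : b < -(2 * H)) :
    gaussianReal 0 1 (Set.Icc b (b + δ)) ≤ ENNReal.ofReal (δ * Real.exp (-H ^ 2)) := by
  refine gaussianReal_Icc_le hδ fun s hs => ?_
  rw [gaussianPDFReal_zero_one]
  have h1 : (√(2 * Real.pi))⁻¹ ≤ 1 := by
    apply inv_le_one_of_one_le₀
    rw [Real.one_le_sqrt]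
    have := Real.pi_gt_three
    linarith
  have h2 : Real.exp (-s ^ 2 / 2) ≤ Real.exp (-H ^ 2) := by
    rw [Real.exp_le_exp]
    have := hs.2
    nlinarith
  calc _ ≤ 1 * Real.exp (-H ^ 2) := by gcongr
    _ = _ := one_mul _

/-- Near facets: the density on the strip is compared with that on the window of width `w = 1 / H`
to its left. The log-ratio is at most half of `2w (4H + 2w) ≤ 14`, hence `exp 7`. -/
theorem gaussianReal_Icc_le_mul_Iio {b δ H : ℝ} (hδ : 0 ≤ δ) (hH : 2 / 3 ≤ H ^ 2) (hH0 : 0 < H)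
    (hδ2 : δ ≤ 1 / H) (hb : -(2 * H) ≤ b) :
    gaussianReal 0 1 (Set.Icc b (b + δ)) ≤
      ENNReal.ofReal (δ * (Real.exp 7 * H)) * gaussianReal 0 1 (Set.Iio b) := by
  set w := 1 / H with hw
  have hw0 : 0 < w := by positivity
  have hwH : w * H = 1 := by rw [hw]; field_simp
  have hw2 : w ^ 2 ≤ 3 / 2 := by
    have : w ^ 2 * H ^ 2 = 1 := by rw [← mul_pow, hwH, one_pow]
    nlinarith [sq_nonneg w]
  have pdf : ∀ s ∈ Set.Icc b (b + δ), ∀ s' ∈ Set.Ico (b - w) b,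
      gaussianPDFReal 0 1 s ≤ Real.exp 7 * gaussianPDFReal 0 1 s' := by
    intro s hs s' hs'
    rw [gaussianPDFReal_zero_one, gaussianPDFReal_zero_one, mul_left_comm, ← Real.exp_add]
    gcongr
    have h1 := hs.1
    have h2 := hs.2
    have h3 := hs'.1
    have h4 := hs'.2
    have h5 : 0 ≤ s - s' := by linarith
    have h6 : s - s' ≤ 2 * w := by linarith
    have h7 : -(s + s') ≤ 4 * H + 2 * w := by linarith
    have : (s - s') * (-(s + s')) ≤ 2 * w * (4 * H + 2 * w) := by
      rcases le_or_gt (s + s') 0 with h | h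
      · exact mul_le_mul h6 h7 (by linarith) (by positivity)
      · have : 0 ≤ 2 * w * (4 * H + 2 * w) := by positivity
        nlinarith
    nlinarith
  have bd : ∀ s ∈ Set.Icc b (b + δ), gaussianPDFReal 0 1 s ≤
      (Real.exp 7 * H) * (gaussianReal 0 1).real (Set.Iio b) := by
    intro s hs
    have i : ∫ _ in Set.Ico (b - w) b, gaussianPDFReal 0 1 s ≤
        ∫ s' in Set.Ico (b - w) b, Real.exp 7 * gaussianPDFReal 0 1 s' :=
      setIntegral_mono_on (integrableOn_const (by simp))
        ((integrable_gaussianPDFReal 0 1).const_mul _).integrableOn measurableSet_Ico (pdf s hs)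
    rw [setIntegral_const, integral_const_mul, Real.volume_real_Ico_of_le (by linarith)] at i
    have e1 : ∫ s' in Set.Ico (b - w) b, gaussianPDFReal 0 1 s' =
        (gaussianReal 0 1).real (Set.Ico (b - w) b) := by
      have := setIntegral_gaussianReal (Set.Ico (b - w) b) measurableSet_Ico (fun _ => 1)
      simp only [setIntegral_one_eq_measureReal, one_mul] at this
      exact this.symm
    rw [e1, show b - (b - w) = w by ring, smul_eq_mul] at i
    have e2 : (gaussianReal 0 1).real (Set.Ico (b - w) b) ≤ (gaussianReal 0 1).real (Set.Iio b) :=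
      measureReal_mono fun s hs => hs.2
    calc gaussianPDFReal 0 1 s = H * (w * gaussianPDFReal 0 1 s) := by
          rw [← mul_assoc, mul_comm H, hwH, one_mul]
      _ ≤ H * (Real.exp 7 * (gaussianReal 0 1).real (Set.Iio b)) := by
          exact mul_le_mul_of_nonneg_left (i.trans (by gcongr)) hH0.le
      _ = _ := by ring
  refine (gaussianReal_Icc_le hδ bd).trans ?_
  rw [← mul_assoc, ENNReal.ofReal_mul (by positivity), ofReal_measureReal]

/-- Nazarov's bound for the Gaussian measure of a thin shell at the boundary of a polyhedron. -/
theorem stdGaussian_shell_le {d K : ℕ} (hK : 0 < K) (S : Finset (Fin K)) (u : Fin K → RSpace d)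
    (t : Fin K → ℝ) (hu : ∀ i ∈ S, ‖u i‖ = 1) {δ : ℝ} (hδ : 0 < δ)
    (hδ1 : δ ≤ √(Real.log (K + 1)) / 2) (hδ2 : δ ≤ 1 / √(Real.log (K + 1))) :
    stdGaussian (RSpace d) {x | (∀ i ∈ S, 0 ≤ ⟪u i, x⟫_ℝ + t i) ∧ ∃ i ∈ S, ⟪u i, x⟫_ℝ + t i ≤ δ} ≤
      ENNReal.ofReal (δ * ((Real.exp 7 + 2) * √(Real.log (K + 1)))) := by
  set H := √(Real.log (K + 1)) with hHdef
  set γ := stdGaussian (RSpace d)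
  have hK1 : (1 : ℝ) ≤ K := by exact_mod_cast hK
  have hlog : 2 / 3 ≤ Real.log (K + 1) := by
    have h2 : Real.log 2 ≤ Real.log (K + 1) := Real.log_le_log (by norm_num) (by linarith)
    have := Real.log_two_gt_d9
    linarith
  have hH2 : H ^ 2 = Real.log (K + 1) := Real.sq_sqrt (by linarith)
  have hHh : 1 / 2 ≤ H := by
    rw [hHdef, Real.le_sqrt (by norm_num) (by linarith)]; linarith
  have hH0 : 0 < H := by linarith
  let v : Fin K → RSpace d → ℝ := fun i x => ⟪u i, x⟫_ℝ + t i
  have hv : ∀ i, Measurable (v i) := fun i => by fun_prop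
  -- `C i` is the cell where constraint `i` has the least slack. Breaking ties by index makes the
  -- cells disjoint.
  let C : Fin K → Set (RSpace d) := fun i => {x | ∀ j ∈ S, v i x < v j x ∨ (v i x = v j x ∧ i ≤ j)}
  have hC : ∀ i, MeasurableSet (C i) := by
    intro i
    simp only [C, Set.ofPred_forall]
    refine MeasurableSet.iInter fun j => MeasurableSet.iInter fun _ => ?_
    exact (measurableSet_lt (hv i) (hv j)).union
      ((measurableSet_eq_fun (hv i) (hv j)).inter (MeasurableSet.const _))
  have cover : {x | (∀ i ∈ S, 0 ≤ ⟪u i, x⟫_ℝ + t i) ∧ ∃ i ∈ S, ⟪u i, x⟫_ℝ + t i ≤ δ} ⊆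
      ⋃ i ∈ S, C i ∩ {x | ⟪u i, x⟫_ℝ ∈ Set.Icc (-t i) (-t i + δ)} := by
    rintro x ⟨hx, i₀, hi₀, hxi₀⟩
    obtain ⟨i, hi, hmin⟩ := S.exists_min_image (fun i => toLex (v i x, i)) ⟨i₀, hi₀⟩
    have hmin' : ∀ j ∈ S, v i x < v j x ∨ (v i x = v j x ∧ i ≤ j) := fun j hj => by
      have := hmin j hj
      rwa [Prod.Lex.toLex_le_toLex] at this
    simp only [Set.mem_iUnion]
    refine ⟨i, hi, hmin', ?_⟩
    have h1 := hx i hi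
    have h2 : v i x ≤ v i₀ x := by
      rcases hmin' i₀ hi₀ with h | h
      · exact h.le
      · exact h.1.le
    have h3 : ⟪u i, x⟫_ℝ + t i ≤ δ := h2.trans hxi₀
    constructor <;> linarith
  -- Moving along `-u i` lowers slack `i` at rate `1` and every other slack at rate at most `1`, so
  -- the point stays in `C i`. On a line meeting both the cell and the strip, the entire half-line
  -- below the strip therefore lies in `C i`.
  have down : ∀ i ∈ S, ∀ (y : RSpace d) (s r : ℝ), r ≤ s → s • u i + y ∈ C i →
      r • u i + y ∈ C i := by
    intro i hi y s r hrs hx j hj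
    have hii : ⟪u i, u i⟫_ℝ = 1 := by rw [real_inner_self_eq_norm_sq, hu i hi]; norm_num
    have hij : ⟪u j, u i⟫_ℝ ≤ 1 := by
      refine (real_inner_le_norm _ _).trans ?_
      rw [hu i hi, hu j hj]; norm_num
    have h := hx j hj
    simp only [v, inner_add_right, inner_smul_right, hii] at h ⊢
    have hm : (s - r) * ⟪u j, u i⟫_ℝ ≤ (s - r) * 1 := by
      apply mul_le_mul_of_nonneg_left hij; linarith
    rcases h with h | ⟨h, h'⟩
    · left; nlinarith
    · rcases hm.lt_or_eq with hm | hm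
      · left; nlinarith
      · right; exact ⟨by nlinarith, h'⟩
  have piece : ∀ i ∈ S, γ (C i ∩ {x | ⟪u i, x⟫_ℝ ∈ Set.Icc (-t i) (-t i + δ)}) ≤
      ENNReal.ofReal (δ * (Real.exp 7 * H)) * γ (C i) + ENNReal.ofReal (δ * Real.exp (-H ^ 2)) := by
    intro i hi
    have hmI : MeasurableSet {x : RSpace d | ⟪u i, x⟫_ℝ ∈ Set.Icc (-t i) (-t i + δ)} :=
      measurableSet_Icc.preimage (by fun_prop)
    rcases lt_or_ge (-t i) (-(2 * H)) with hb | hb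
    · refine le_add_left ?_
      refine le_trans ?_ (gaussianReal_Icc_le_of_tail hδ.le hδ1 hb)
      rw [← stdGaussian_map_inner (hu i hi), Measure.map_apply (by fun_prop) measurableSet_Icc]
      exact measure_mono Set.inter_subset_right
    · refine le_add_right ?_
      rw [stdGaussian_eq_lintegral_lines (hu i hi) ((hC i).inter hmI),
        stdGaussian_eq_lintegral_lines (hu i hi) (hC i), ← lintegral_const_mul']
      swap; · exact ENNReal.ofReal_ne_top
      have hmR : Measurable fun x : RSpace d => x - ⟪u i, x⟫_ℝ • u i := by fun_prop
      have orth : ∀ᵐ y ∂(γ.map fun x => x - ⟪u i, x⟫_ℝ • u i), ⟪u i, y⟫_ℝ = 0 := by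
        rw [ae_map_iff hmR.aemeasurable (measurableSet_eq_fun (by fun_prop) measurable_const)]
        refine ae_of_all _ fun x => ?_
        simp [inner_sub_right, inner_smul_right, hu i hi]
      refine lintegral_mono_ae ?_
      filter_upwards [orth] with y hy
      have hs : ∀ s : ℝ, ⟪u i, s • u i + y⟫_ℝ = s := fun s => by
        simp [inner_add_right, inner_smul_right, hu i hi, hy]
      rcases Set.eq_empty_or_nonempty {s : ℝ | s • u i + y ∈ C i ∩
        {x | ⟪u i, x⟫_ℝ ∈ Set.Icc (-t i) (-t i + δ)}} with h | ⟨s, hsC, hsI⟩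
      · rw [h]; simp
      · rw [Set.mem_ofPred_eq, hs] at hsI
        calc _ ≤ gaussianReal 0 1 (Set.Icc (-t i) (-t i + δ)) := by
              refine measure_mono fun r hr => ?_
              have := hr.2
              rwa [Set.mem_ofPred_eq, hs] at this
          _ ≤ _ := gaussianReal_Icc_le_mul_Iio hδ.le (by rw [hH2]; exact hlog) hH0 hδ2 hb
          _ ≤ _ := by
              gcongr
              intro r (hr : r < -t i)
              exact down i hi y s r (hr.le.trans hsI.1) hsC
  have disj : (S : Set (Fin K)).PairwiseDisjoint C := by
    intro i hi j hj hij
    rw [Function.onFun, Set.disjoint_left]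
    intro x hxi hxj
    rcases hxi j hj with h | ⟨h, h'⟩
    · rcases hxj i hi with k | ⟨k, k'⟩ <;> linarith
    · rcases hxj i hi with k | ⟨k, k'⟩
      · linarith
      · exact hij (le_antisymm h' k')
  have sumC : ∑ i ∈ S, γ (C i) ≤ 1 := by
    rw [← measure_biUnion_finset disj fun i _ => hC i]
    exact prob_le_one
  calc _ ≤ ∑ i ∈ S, γ (C i ∩ {x | ⟪u i, x⟫_ℝ ∈ Set.Icc (-t i) (-t i + δ)}) :=
        (measure_mono cover).trans (measure_biUnion_finset_le _ _)
    _ ≤ ∑ i ∈ S, (ENNReal.ofReal (δ * (Real.exp 7 * H)) * γ (C i) +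
          ENNReal.ofReal (δ * Real.exp (-H ^ 2))) := Finset.sum_le_sum piece
    _ = ENNReal.ofReal (δ * (Real.exp 7 * H)) * (∑ i ∈ S, γ (C i)) +
          S.card * ENNReal.ofReal (δ * Real.exp (-H ^ 2)) := by
        rw [Finset.sum_add_distrib, Finset.mul_sum, Finset.sum_const, nsmul_eq_mul]
    _ ≤ ENNReal.ofReal (δ * (Real.exp 7 * H)) * 1 +
          K * ENNReal.ofReal (δ * Real.exp (-H ^ 2)) := by
        gcongr
        exact_mod_cast (Finset.card_le_univ S).trans_eq (Fintype.card_fin K)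
    _ = ENNReal.ofReal (δ * (Real.exp 7 * H) + K * (δ * Real.exp (-H ^ 2))) := by
        rw [mul_one, ENNReal.ofReal_add (by positivity) (by positivity),
          ENNReal.ofReal_mul (p := (K : ℝ)) (by positivity), ENNReal.ofReal_natCast]
    _ ≤ _ := by
        apply ENNReal.ofReal_le_ofReal
        -- The choice `H² = log (K + 1)` makes the far facets contribute at most `K / (K + 1)` in
        -- total.
        have : K * Real.exp (-H ^ 2) ≤ 1 := by
          rw [hH2, Real.exp_neg, Real.exp_log (by linarith), ← div_eq_mul_inv,
            div_le_one (by linarith)]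
          linarith
        have h2 : K * Real.exp (-H ^ 2) ≤ 2 * H := by linarith
        nlinarith

theorem gaussianSurfaceArea_le_of_shell {d : ℕ} {A : Set (RSpace d)} {M δ₀ : ℝ} (hδ₀ : 0 < δ₀)
    (h : ∀ δ, 0 < δ → δ ≤ δ₀ →
      stdGaussian (RSpace d) (Metric.cthickening δ A \ A) ≤ ENNReal.ofReal (δ * M)) :
    gaussianSurfaceArea A ≤ ENNReal.ofReal M := by
  unfold gaussianSurfaceArea
  refine (liminf_le_liminf (v := fun _ => ENNReal.ofReal M) ?_).trans_eq (by simp)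
  have : ∀ᶠ δ in 𝓝[>] (0 : ℝ), δ ∈ Set.Ioc 0 δ₀ := Ioc_mem_nhdsGT hδ₀
  filter_upwards [this] with δ hδ
  refine ENNReal.div_le_of_le_mul ?_
  rw [mul_comm, ← ENNReal.ofReal_mul hδ.1.le]
  exact h δ hδ.1 hδ.2

theorem gaussianSurfaceArea_empty {d : ℕ} : gaussianSurfaceArea (∅ : Set (RSpace d)) = 0 := by
  simp [gaussianSurfaceArea]

theorem gaussianSurfaceArea_univ {d : ℕ} : gaussianSurfaceArea (Set.univ : Set (RSpace d)) = 0 := by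
  simp [gaussianSurfaceArea]

/-- After discarding zero normals and normalising the rest, the outer layer of the polyhedron lies
in the shell of the polyhedron relaxed by `δ`, and the outer layer of the complement in the shell of
the polyhedron itself. -/
theorem gaussianSurfaceArea_polyhedron_le {d K : ℕ} (hK : 0 < K) (w : Fin K → RSpace d)
    (t : Fin K → ℝ) :
    gaussianSurfaceArea {x | ∀ i, 0 ≤ ⟪w i, x⟫_ℝ + t i} ≤
      ENNReal.ofReal ((Real.exp 7 + 2) * √(Real.log (K + 1))) ∧
    gaussianSurfaceArea {x | ∀ i, 0 ≤ ⟪w i, x⟫_ℝ + t i}ᶜ ≤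
      ENNReal.ofReal ((Real.exp 7 + 2) * √(Real.log (K + 1))) := by
  by_cases hvoid : ∃ i, w i = 0 ∧ t i < 0
  · obtain ⟨i, hi, ht⟩ := hvoid
    have : {x | ∀ i, 0 ≤ ⟪w i, x⟫_ℝ + t i} = ∅ := by
      ext x
      simp only [Set.mem_ofPred_eq, Set.mem_empty_iff_false, iff_false, not_forall]
      refine ⟨i, ?_⟩
      simp [hi, ht]
    rw [this, Set.compl_empty, gaussianSurfaceArea_empty, gaussianSurfaceArea_univ]
    simp
  push Not at hvoid
  classical
  set S : Finset (Fin K) := Finset.univ.filter fun i => w i ≠ 0 with hS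
  set u : Fin K → RSpace d := fun i => ‖w i‖⁻¹ • w i
  set b : Fin K → ℝ := fun i => ‖w i‖⁻¹ * t i
  have hu : ∀ i ∈ S, ‖u i‖ = 1 := by
    intro i hi
    have : ‖w i‖ ≠ 0 := norm_ne_zero_iff.2 (Finset.mem_filter.1 hi).2
    simp only [u, norm_smul, norm_inv, norm_norm]
    field_simp
  have hA : {x | ∀ i, 0 ≤ ⟪w i, x⟫_ℝ + t i} = {x | ∀ i ∈ S, 0 ≤ ⟪u i, x⟫_ℝ + b i} := by
    ext x
    have e : ∀ i, ⟪u i, x⟫_ℝ + b i = ‖w i‖⁻¹ * (⟪w i, x⟫_ℝ + t i) := fun i => by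
      simp only [u, b, inner_smul_left]; simp; ring
    simp only [Set.mem_ofPred_eq, e]
    constructor
    · intro h i _
      exact mul_nonneg (by positivity) (h i)
    · intro h i
      by_cases hi : w i = 0
      · simpa [hi] using hvoid i hi
      · have h1 := h i (by simp [hS, hi])
        have : 0 < ‖w i‖⁻¹ := inv_pos.2 (norm_pos_iff.2 hi)
        exact nonneg_of_mul_nonneg_right h1 this
  rw [hA]
  set A : Set (RSpace d) := {x | ∀ i ∈ S, 0 ≤ ⟪u i, x⟫_ℝ + b i} with hAdef
  set H := √(Real.log (K + 1))
  have hH0 : 0 < H := by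
    apply Real.sqrt_pos.2
    apply Real.log_pos
    have : (1 : ℝ) ≤ K := by exact_mod_cast hK
    linarith
  have hclosed : IsClosed A := by
    simp only [hAdef, Set.ofPred_forall]
    exact isClosed_iInter fun i => isClosed_iInter fun _ =>
      isClosed_le continuous_const (by fun_prop)
  have close : ∀ i ∈ S, ∀ x y : RSpace d, ∀ δ, dist x y ≤ δ → ⟪u i, x⟫_ℝ ≤ ⟪u i, y⟫_ℝ + δ := by
    intro i hi x y δ hxy
    have h1 := real_inner_le_norm (u i) (x - y)
    rw [inner_sub_right, hu i hi, one_mul, ← dist_eq_norm] at h1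
    linarith
  have hδ₀ : 0 < min (H / 2) (1 / H) := by positivity
  constructor
  · refine gaussianSurfaceArea_le_of_shell hδ₀ fun δ hδ hδ' => ?_
    refine le_trans (measure_mono ?_) (stdGaussian_shell_le hK S u (fun i => b i + δ) hu hδ
      (hδ'.trans (min_le_left _ _)) (hδ'.trans (min_le_right _ _)))
    rintro x ⟨hx, hxA⟩
    rw [hclosed.cthickening_eq_biUnion_closedBall hδ.le] at hx
    simp only [Set.mem_iUnion, Metric.mem_closedBall] at hx
    obtain ⟨a, ha, hxa⟩ := hx
    simp only [hAdef, Set.mem_ofPred_eq, not_forall, not_le] at hxA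
    obtain ⟨i, hi, hxi⟩ := hxA
    refine ⟨fun j hj => ?_, i, hi, by linarith⟩
    have h1 := close j hj a x δ (by rwa [dist_comm])
    have h2 := ha j hj
    linarith
  · refine gaussianSurfaceArea_le_of_shell hδ₀ fun δ hδ hδ' => ?_
    refine le_trans (measure_mono ?_) (stdGaussian_shell_le hK S u b hu hδ
      (hδ'.trans (min_le_left _ _)) (hδ'.trans (min_le_right _ _)))
    rintro x ⟨hx, hxA⟩
    rw [Set.mem_compl_iff, not_not] at hxA
    have hcl : closure Aᶜ ⊆ ⋃ i ∈ S, {x | ⟪u i, x⟫_ℝ + b i ≤ 0} := by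
      refine closure_minimal ?_ ?_
      · intro z hz
        simp only [hAdef, Set.mem_compl_iff, Set.mem_ofPred_eq, not_forall, not_le] at hz
        obtain ⟨i, hi, hzi⟩ := hz
        simp only [Set.mem_iUnion]
        exact ⟨i, hi, hzi.le⟩
      · exact isClosed_biUnion_finset fun i _ => isClosed_le (by fun_prop) continuous_const
    rw [← Metric.cthickening_closure, isClosed_closure.cthickening_eq_biUnion_closedBall hδ.le] at hx
    simp only [Set.mem_iUnion, Metric.mem_closedBall] at hx
    obtain ⟨a, ha, hxa⟩ := hx
    have := hcl ha
    simp only [Set.mem_iUnion] at this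
    obtain ⟨i, hi, hai⟩ := this
    have hai : ⟪u i, a⟫_ℝ + b i ≤ 0 := hai
    refine ⟨hxA, i, hi, ?_⟩
    have h1 := close i hi x a δ hxa
    linarith

/-! ### Effect of label noise on Gaussian moments. -/

theorem integrable_sq_mul_exp_gaussianReal :
    Integrable (fun s : ℝ => s ^ 2 * Real.exp (s ^ 2 / 4)) (gaussianReal 0 1) := by
  rw [integrable_gaussianReal_iff]
  have := (integrable_rpow_mul_exp_neg_mul_sq (b := 1 / 4) (by norm_num) (s := 2)
    (by norm_num)).const_mul (√(2 * Real.pi))⁻¹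
  refine this.congr (ae_of_all _ fun s => ?_)
  simp only
  rw [gaussianPDFReal_zero_one, mul_assoc, mul_left_comm (Real.exp _), ← Real.exp_add]
  have e : s ^ 2 / 4 + -s ^ 2 / 2 = -(1 / 4) * s ^ 2 := by ring
  rw [e]
  norm_cast
  ring

/-- Moments of a standard Gaussian variable over an event of small probability. -/
theorem exists_noise_bound : ∃ C : ℝ, 0 < C ∧ ∀ (Ω : Type) [MeasurableSpace Ω] (Q : Measure Ω)
    [IsProbabilityMeasure Q] (s : Ω → ℝ) (B : Set Ω) (L : ℝ), Measurable s →
    Q.map s = gaussianReal 0 1 → MeasurableSet B → 0 < L →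
    ∫ ω in B, s ω ^ 2 ∂Q ≤ C * (L * Q.real B + Real.exp (-L)) ∧
    ∫ ω in B, |s ω| ∂Q ≤ C * (L * Q.real B + Real.exp (-L)) / √L := by
  set C₀ := ∫ s : ℝ, s ^ 2 * Real.exp (s ^ 2 / 4) ∂(gaussianReal 0 1) with hC₀
  have hC₀0 : 0 ≤ C₀ := integral_nonneg fun s => by positivity
  refine ⟨5 + C₀, by positivity, fun Ω _ Q _ s B L hs hQ hB hL => ?_⟩
  have i2 : Integrable (fun ω => s ω ^ 2) Q := by
    have := integrable_pow_gaussianReal 2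
    rw [← hQ] at this
    exact this.comp_measurable hs
  have i1 : Integrable (fun ω => |s ω|) Q := by
    have := integrable_id_gaussianReal'.abs
    rw [← hQ] at this
    exact this.comp_measurable hs
  have ie : Integrable (fun ω => s ω ^ 2 * Real.exp (s ω ^ 2 / 4)) Q := by
    have := integrable_sq_mul_exp_gaussianReal
    rw [← hQ] at this
    exact this.comp_measurable hs
  have z0 : 0 ≤ Q.real B := measureReal_nonneg
  have e0 : 0 < Real.exp (-L) := Real.exp_pos _
  have sq : ∫ ω in B, s ω ^ 2 ∂Q ≤ 4 * L * Q.real B + C₀ * Real.exp (-L) := by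
    -- Truncation at `s² = 4L`: beyond it the exponential factor is at least `1`.
    have pw : ∀ ω, s ω ^ 2 ≤ 4 * L + s ω ^ 2 * Real.exp (s ω ^ 2 / 4) * Real.exp (-L) := by
      intro ω
      rcases le_or_gt (s ω ^ 2) (4 * L) with h | h
      · have : 0 ≤ s ω ^ 2 * Real.exp (s ω ^ 2 / 4) * Real.exp (-L) := by positivity
        linarith
      · rw [mul_assoc, ← Real.exp_add]
        have : 1 ≤ Real.exp (s ω ^ 2 / 4 + -L) := Real.one_le_exp (by linarith)
        nlinarith [sq_nonneg (s ω)]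
    calc ∫ ω in B, s ω ^ 2 ∂Q ≤
          ∫ ω in B, (4 * L + s ω ^ 2 * Real.exp (s ω ^ 2 / 4) * Real.exp (-L)) ∂Q :=
          integral_mono i2.integrableOn (Integrable.integrableOn (μ := Q)
            (f := fun ω => 4 * L + s ω ^ 2 * Real.exp (s ω ^ 2 / 4) * Real.exp (-L))
            ((integrable_const (4 * L)).add (ie.mul_const (Real.exp (-L))))) pw
      _ = 4 * L * Q.real B +
          (∫ ω in B, s ω ^ 2 * Real.exp (s ω ^ 2 / 4) ∂Q) * Real.exp (-L) := by
          rw [integral_add (integrable_const _) (ie.mul_const _).integrableOn,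
            integral_mul_const (Real.exp (-L)), setIntegral_const, smul_eq_mul, mul_comm (Q.real B)]
      _ ≤ _ := by
          gcongr
          rw [hC₀, ← hQ, integral_map hs.aemeasurable (by fun_prop)]
          exact setIntegral_le_integral ie (ae_of_all _ fun ω => by positivity)
  constructor
  · refine sq.trans ?_
    nlinarith [mul_nonneg hL.le z0, mul_nonneg hC₀0 (mul_nonneg hL.le z0)]
  · have hsL : 0 < √L := Real.sqrt_pos.2 hL
    have hss : √L * √L = L := Real.mul_self_sqrt hL.le
    have pw : ∀ ω, |s ω| ≤ √L / 2 + s ω ^ 2 * (1 / (2 * √L)) := by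
      intro ω
      have e : √L / 2 + s ω ^ 2 * (1 / (2 * √L)) - |s ω| = (√L - |s ω|) ^ 2 * (1 / (2 * √L)) := by
        rw [← sq_abs (s ω)]; field_simp; ring
      have : 0 ≤ (√L - |s ω|) ^ 2 * (1 / (2 * √L)) := by positivity
      linarith
    calc ∫ ω in B, |s ω| ∂Q ≤ ∫ ω in B, (√L / 2 + s ω ^ 2 * (1 / (2 * √L))) ∂Q :=
          integral_mono i1.integrableOn (Integrable.integrableOn (μ := Q)
            (f := fun ω => √L / 2 + s ω ^ 2 * (1 / (2 * √L)))
            ((integrable_const (√L / 2)).add (i2.mul_const (1 / (2 * √L))))) pw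
      _ = √L / 2 * Q.real B + (∫ ω in B, s ω ^ 2 ∂Q) * (1 / (2 * √L)) := by
          rw [integral_add (integrable_const _) (i2.mul_const _).integrableOn,
            integral_mul_const, setIntegral_const, smul_eq_mul, mul_comm (Q.real B)]
      _ ≤ √L / 2 * Q.real B + (4 * L * Q.real B + C₀ * Real.exp (-L)) * (1 / (2 * √L)) := by
          gcongr
      _ = (5 * (L * Q.real B) + C₀ * Real.exp (-L)) / 2 / √L := by
          rw [eq_div_iff hsL.ne']
          have : (4 * L * Q.real B + C₀ * Real.exp (-L)) * (1 / (2 * √L)) * √L =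
            (4 * L * Q.real B + C₀ * Real.exp (-L)) / 2 := by field_simp
          rw [add_mul, this]
          linear_combination (Q.real B / 2) * hss
      _ ≤ _ := by
          gcongr
          nlinarith [mul_nonneg hL.le z0, mul_nonneg hC₀0 (mul_nonneg hL.le z0),
            mul_nonneg hC₀0 e0.le]

/-- The last bound turns the truncation error `exp (-L)` into the noise rate; the third absorbs the
logarithm when the rate is a square. -/
theorem log_inv_add_one_bounds {z : ℝ} (hz : 0 < z) (hz1 : z ≤ 1) :
    2 / 3 ≤ Real.log (1 / z + 1) ∧ Real.log (1 / z + 1) ≤ 1 / z ∧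
      z * Real.log (1 / z + 1) ≤ 2 * √z ∧ Real.exp (-Real.log (1 / z + 1)) ≤ z := by
  have h1 : 1 ≤ 1 / z := by rw [le_div_iff₀ hz]; linarith
  refine ⟨?_, ?_, ?_, ?_⟩
  · have h2 : Real.log 2 ≤ Real.log (1 / z + 1) := Real.log_le_log (by norm_num) (by linarith)
    have := Real.log_two_gt_d9
    linarith
  · have := Real.log_le_sub_one_of_pos (show 0 < 1 / z + 1 by linarith)
    linarith
  · have h2 : Real.log (1 / z + 1) ≤ 2 * √(1 / z) := by
      have h3 : Real.log (1 / z + 1) = 2 * Real.log (√(1 / z + 1)) := by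
        rw [Real.log_sqrt (by linarith)]; ring
      have h4 := Real.log_le_sub_one_of_pos (show 0 < √(1 / z + 1) from Real.sqrt_pos.2 (by linarith))
      have h5 : √(1 / z + 1) ≤ √(1 / z) + 1 := by
        rw [Real.sqrt_le_left (by positivity)]
        nlinarith [Real.sq_sqrt (show 0 ≤ 1 / z by linarith), Real.sqrt_nonneg (1 / z)]
      linarith
    have h6 : z * √(1 / z) = √z := by
      have : √(1 / z) = 1 / √z := by rw [Real.sqrt_div zero_le_one, Real.sqrt_one]
      rw [this, mul_one_div, Real.div_sqrt]
    calc z * Real.log (1 / z + 1) ≤ z * (2 * √(1 / z)) := by gcongr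
      _ = 2 * (z * √(1 / z)) := by ring
      _ = _ := by rw [h6]
  · rw [Real.exp_neg, Real.exp_log (by linarith)]
    have : (1 / z + 1)⁻¹ ≤ (1 / z)⁻¹ := by
      apply inv_anti₀ <;> linarith
    simpa using this

/-! ### A quadratic correlating with a polyhedron. -/

/-- Arithmetic of the small-mean case. Since `β (1 - β)` is at least half of `min β (1 - β)`, the
gain `c₄ β (1 - β) / K` exceeds `c₄ (C N / 2 + ε / (8 K))`; the first summand pays for the noise,
the second for the required margin. -/
theorem quadratic_margin {c₀ c₄ C C₁ K N β ε μ L l z : ℝ} (hc₄ : 0 < c₄)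
    (hC₁ : 0 < C₁) (hCC₂ : 3 / 2 + 5 / 2 * C₁ ≤ c₄ * C / 2) (hK1 : 1 ≤ K) (hN : 0 < N)
    (hzN : z ≤ 3 / 2 * N) (hL : 2 / 3 ≤ L) (hl : 0 < l) (hlL : l * l = L) (hμ : |μ| ≤ 1 / l)
    (hβ0 : C * K * N + ε / 4 < β) (hβ1 : C * K * N + ε / 4 < 1 - β) (hε : 0 < ε) (hε1 : ε < 1) :
    min (c₄ / 16) (c₀ / 8) * (ε / K) ^ 2 + (|μ| * (C₁ * N / l) + (z + C₁ * N)) <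
      c₄ * (β * ((1 - β) / K)) := by
  have hK0 : 0 < K := by linarith
  have hC : 0 < C := by
    by_contra h
    nlinarith
  have hCKN : 0 < C * K * N := by positivity
  have hεK : ε / K ≤ ε := div_le_self hε.le hK1
  have hεK0 : 0 < ε / K := by positivity
  have hββ : (C * K * N + ε / 4) / 2 < β * (1 - β) := by
    rcases le_or_gt β (1 / 2) with h | h <;> nlinarith
  have h3 : c₄ * (C * N / 2 + ε / K / 8) < c₄ * (β * ((1 - β) / K)) := by
    refine mul_lt_mul_of_pos_left ?_ hc₄
    rw [← mul_div_assoc, lt_div_iff₀ hK0]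
    have : (C * N / 2 + ε / K / 8) * K = (C * K * N + ε / 4) / 2 := by field_simp; ring
    rw [this]; exact hββ
  refine lt_of_le_of_lt ?_ h3
  have n1 : |μ| * (C₁ * N / l) ≤ C₁ * N * (3 / 2) := by
    calc |μ| * (C₁ * N / l) ≤ 1 / l * (C₁ * N / l) := by gcongr
      _ = C₁ * N * (1 / L) := by
          rw [div_mul_div_comm, hlL]; ring
      _ ≤ _ := by
          refine mul_le_mul_of_nonneg_left ?_ (by positivity)
          rw [div_le_iff₀ (by linarith)]; linarith
  have n2 : min (c₄ / 16) (c₀ / 8) * (ε / K) ^ 2 ≤ c₄ / 16 * (ε / K) := by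
    have : (ε / K) ^ 2 ≤ ε / K := by nlinarith
    calc _ ≤ c₄ / 16 * (ε / K) ^ 2 := by gcongr; exact min_le_left _ _
      _ ≤ _ := by gcongr
  have n3 : (3 / 2 + 5 / 2 * C₁) * N ≤ c₄ * C / 2 * N := by gcongr
  have n5 : 0 < c₄ * (ε / K) := by positivity
  linarith

/-- An intersection of halfspaces that is far from constant correlates with a quadratic polynomial
in the direction of one of its normals, by more than the effect of label noise of rate `z`. -/
theorem exists_quadratic_correlation (C₁ : ℝ) (hC₁ : 0 < C₁) : ∃ C c₁ : ℝ, 1 ≤ C ∧ 0 < c₁ ∧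
    ∀ (c₀ : ℝ), 0 < c₀ → ∀ (d K : ℕ) (a : Fin K → RSpace d) (b : Fin K → ℝ) (z ζ ε : ℝ),
    0 < K → 0 ≤ z → 0 < ζ → ζ ≤ 1 → 0 < ε → ε < 1 → (c₀ * (ε / K)) ^ 2 ≤ ζ →
    C * K * (Real.log (1 / ζ + 1) * z + ζ) + ε / 4 <
      min ((stdGaussian (RSpace d)).real {x | ∀ i, 0 ≤ ⟪a i, x⟫_ℝ + b i})
        (1 - (stdGaussian (RSpace d)).real {x | ∀ i, 0 ≤ ⟪a i, x⟫_ℝ + b i}) →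
    ∃ i, a i ≠ 0 ∧ ∃ α₁ α₂ : ℝ, α₁ ^ 2 + 2 * α₂ ^ 2 ≤ 4 ∧
      min c₁ (c₀ / 8) * (ε / K) ^ 2 + (|α₁| * (C₁ * (Real.log (1 / ζ + 1) * z + ζ) /
          √(Real.log (1 / ζ + 1))) + |α₂| * (z + C₁ * (Real.log (1 / ζ + 1) * z + ζ))) <
        ∫ x in {x | ∀ i, 0 ≤ ⟪a i, x⟫_ℝ + b i}, (α₁ * ⟪‖a i‖⁻¹ • a i, x⟫_ℝ +
          α₂ * (1 - ⟪‖a i‖⁻¹ • a i, x⟫_ℝ ^ 2)) ∂(stdGaussian (RSpace d)) := by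
  obtain ⟨c₂, hc₂, H₂⟩ := exists_convex_contraction
  obtain ⟨c₃, hc₃, H₃⟩ := exists_tail_shift
  set C₂ := 3 / 2 + 5 / 2 * C₁ with hC₂
  set c₄ := c₂ * c₃ with hc₄
  have hc₄0 : 0 < c₄ := by positivity
  refine ⟨max (max 1 C₁) (2 * C₂ / c₄), c₄ / 16, (le_max_left _ _).trans (le_max_left _ _),
    by positivity, ?_⟩
  intro c₀ hc₀ d K a b z ζ ε hK hz hζ hζ1 hε hε1 hc₀ζ hη
  set C := max (max 1 C₁) (2 * C₂ / c₄)
  have hC1 : 1 ≤ C := (le_max_left _ _).trans (le_max_left _ _)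
  have hCC₁ : C₁ ≤ C := (le_max_right _ _).trans (le_max_left _ _)
  have hCC₂ : C₂ ≤ c₄ * C / 2 := by
    have : 2 * C₂ / c₄ ≤ C := le_max_right _ _
    rw [div_le_iff₀ hc₄0] at this
    linarith
  obtain ⟨hL, hLζ, -, -⟩ := log_inv_add_one_bounds hζ hζ1
  set L := Real.log (1 / ζ + 1) with hLdef
  set N := L * z + ζ with hN
  set γ := stdGaussian (RSpace d)
  set A : Set (RSpace d) := {x | ∀ i, 0 ≤ ⟪a i, x⟫_ℝ + b i} with hA
  set β := γ.real A
  have hK1 : (1 : ℝ) ≤ K := by exact_mod_cast hK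
  have hK0 : (0 : ℝ) < K := by linarith
  have hLz : 0 ≤ L * z := mul_nonneg (by linarith) hz
  have hN0 : 0 < N := by linarith
  have hzN : z ≤ 3 / 2 * N := by nlinarith
  have hβ0 : C * K * N + ε / 4 < β := hη.trans_le (min_le_left _ _)
  have hβ1 : C * K * N + ε / 4 < 1 - β := hη.trans_le (min_le_right _ _)
  have hCKN : 0 < C * K * N := by positivity
  have hεK : ε / K ≤ ε := div_le_self hε.le hK1
  have hεK0 : 0 < ε / K := by positivity
  obtain ⟨i, hai, hi⟩ := exists_facet hK a b (show 0 < β by linarith) (show β < 1 by linarith)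
  have hn : 0 < ‖a i‖ := norm_pos_iff.2 hai
  have he : ‖(‖a i‖⁻¹ • a i)‖ = 1 := by
    rw [norm_smul, norm_inv, norm_norm]; field_simp
  set e := ‖a i‖⁻¹ • a i
  set T := b i / ‖a i‖
  set δ := (gaussianReal 0 1).real (Set.Iio (-T))
  have hAm : MeasurableSet A := by
    rw [hA, Set.ofPred_forall]
    exact MeasurableSet.iInter fun i => measurableSet_le measurable_const (by fun_prop)
  have hAc : Convex ℝ A := by
    rw [hA, Set.ofPred_forall]
    refine convex_iInter fun i => ?_
    have := convex_halfSpace_ge (𝕜 := ℝ) (f := fun x => ⟪a i, x⟫_ℝ)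
      (IsLinearMap.mk (fun x y => inner_add_right _ _ _) (fun c x => inner_smul_right _ _ _)) (-b i)
    have e : {x : RSpace d | 0 ≤ ⟪a i, x⟫_ℝ + b i} = {x | -b i ≤ ⟪a i, x⟫_ℝ} := by
      ext x
      simp only [Set.mem_ofPred_eq]
      constructor <;> intro h <;> linarith
    rw [e]; exact this
  have hAT : ∀ x ∈ A, -T ≤ ⟪e, x⟫_ℝ := by
    intro x hx
    have h := hx i
    have e1 : ⟪e, x⟫_ℝ = ⟪a i, x⟫_ℝ / ‖a i‖ := by
      simp only [e, inner_smul_left]; simp; ring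
    rw [e1, ← neg_div]
    gcongr
    linarith
  have hc := H₂ d A e T hAc hAm he hAT (show 0 < β by linarith)
  set m := ∫ x in A, ⟪e, x⟫_ℝ ∂γ with hm
  set μ := m / β with hμ
  have hβp : 0 < β := by linarith
  have hμβ : μ * β = m := by rw [hμ]; exact div_mul_cancel₀ _ hβp.ne'
  clear_value μ m
  have hsL : 0 < √L := Real.sqrt_pos.2 (by linarith)
  refine ⟨i, hai, ?_⟩
  -- The threshold balances two needs: below it the tail survives a shift by `μ` and the linear term
  -- adds noise only of order `N`; above it the linear correlation `β |μ|` beats the linear noise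
  -- `C₁ N / √L`.
  rcases le_or_gt |μ| (1 / √L) with hsmall | hbig
  · refine ⟨μ, 1, ?_, ?_⟩
    · have h1 : μ ^ 2 ≤ (1 / √L) ^ 2 := by rw [← sq_abs]; gcongr
      rw [div_pow 1, Real.sq_sqrt (show 0 ≤ L by linarith), one_pow] at h1
      have h2 : 1 / L ≤ 3 / 2 := by rw [div_le_iff₀ (by linarith)]; linarith
      linarith
    · have hδ : (1 - β) / K ≤ δ := hi
      -- The facet cuts off mass at least `ζ`, as the shift estimate at level `ζ` requires.
      have hζδ : ζ ≤ δ := by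
        refine le_trans ?_ hδ
        rw [le_div_iff₀ hK0]
        have : 1 * K * ζ ≤ C * K * N := by gcongr; linarith
        linarith
      have hs := H₃ T μ ζ hζ hζ1 hζδ hsmall
      have hint : ∫ x in A, (μ * ⟪e, x⟫_ℝ + 1 * (1 - ⟪e, x⟫_ℝ ^ 2)) ∂γ =
          ∫ x in A, (1 - ⟪e, x⟫_ℝ ^ 2 + μ * ⟪e, x⟫_ℝ) ∂γ := by
        congr 1; ext x; ring
      rw [hint]
      refine lt_of_lt_of_le ?_ hc
      have low : c₄ * (β * ((1 - β) / K)) ≤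
          c₂ * β * (gaussianReal 0 1).real (Set.Iio (-(T + μ))) := by
        calc c₄ * (β * ((1 - β) / K)) ≤ c₂ * β * (c₃ * δ) := by
              rw [hc₄]
              have : c₂ * c₃ * (β * ((1 - β) / K)) = c₂ * β * (c₃ * ((1 - β) / K)) := by ring
              rw [this]; gcongr
          _ ≤ _ := by gcongr
      refine lt_of_lt_of_le ?_ low
      rw [abs_one, one_mul]
      exact quadratic_margin hc₄0 hC₁ hCC₂ hK1 hN0 hzN hL hsL (Real.mul_self_sqrt (by linarith))
        hsmall hβ0 hβ1 hε hε1
  · set sg : ℝ := ((SignType.sign μ : SignType) : ℝ) with hsg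
    have hμ0 : μ ≠ 0 := by
      intro h
      rw [h, abs_zero] at hbig
      have : 0 < 1 / √L := by positivity
      linarith
    have hsg1 : |sg| = 1 := by
      rcases lt_or_gt_of_ne hμ0 with h | h
      · simp [hsg, h]
      · simp [hsg, h]
    refine ⟨sg, 0, ?_, ?_⟩
    · rw [← sq_abs, hsg1]; norm_num
    · have hint : ∫ x in A, (sg * ⟪e, x⟫_ℝ + 0 * (1 - ⟪e, x⟫_ℝ ^ 2)) ∂γ = β * |μ| := by
        simp only [zero_mul, add_zero]
        rw [integral_const_mul, ← hm, ← hμβ, ← mul_assoc, hsg, sign_mul_self, mul_comm]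
      rw [hint, hsg1, abs_zero, zero_mul, add_zero, one_mul]
      have h1 : (C * K * N + ε / 4) * (1 / √L) < β * |μ| :=
        mul_lt_mul'' hβ0 hbig (by positivity) (by positivity)
      refine lt_of_le_of_lt ?_ h1
      have h2 : C₁ * N / √L ≤ C * K * N * (1 / √L) := by
        rw [mul_one_div]
        gcongr
        nlinarith
      -- Here the floor on the noise rate is used: `ζ L ≤ 1` gives `1 / √L ≥ √ζ`.
      have h3 : c₀ * (ε / K) ≤ 1 / √L := by
        have : c₀ * (ε / K) ≤ √ζ := by
          apply Real.le_sqrt_of_sq_le; exact hc₀ζ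
        refine this.trans ?_
        rw [le_div_iff₀ hsL, ← Real.sqrt_mul hζ.le, Real.sqrt_le_one]
        rw [le_div_iff₀ hζ] at hLζ
        linarith
      have h4 : min (c₄ / 16) (c₀ / 8) * (ε / K) ^ 2 ≤ ε / 4 * (1 / √L) := by
        calc _ ≤ c₀ / 8 * (ε / K) ^ 2 := by gcongr; exact min_le_right _ _
          _ = (ε / K) / 8 * (c₀ * (ε / K)) := by ring
          _ ≤ ε / 8 * (1 / √L) := by gcongr
          _ ≤ _ := by gcongr; linarith
      linarith

/-! ### Conditional laws given a projection. -/

section ConditionalLaw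

variable {d : ℕ} (V : Submodule ℝ (RSpace d))

/-- Under the standard Gaussian the projections to a subspace and to its complement are
independent. -/
theorem map_projections_stdGaussian :
    (stdGaussian (RSpace d)).map (fun x => (V.orthogonalProjectionOnto x, Vᗮ.starProjection x)) =
      ((stdGaussian (RSpace d)).map V.orthogonalProjectionOnto).prod
        ((stdGaussian (RSpace d)).map Vᗮ.starProjection) := by
  have hi := indepFun_stdGaussian (E := RSpace d) V.orthogonalProjectionOnto Vᗮ.starProjection
    (fun a b => by
      refine ⟨(a : RSpace d), Vᗮ.starProjection b, fun x => ?_, fun x => ?_, ?_⟩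
      · exact Submodule.inner_orthogonalProjectionOnto_eq_of_mem_left a x
      · exact (Submodule.inner_starProjection_left_eq_right _ b x).symm
      · exact Submodule.inner_right_of_mem_orthogonal a.2 (Submodule.starProjection_apply_mem _ _))
  exact (indepFun_iff_map_prod_eq_prod_map_map (by fun_prop) (by fun_prop)).1 hi

/-- The law of a standard Gaussian vector given its projection to `V`. -/
noncomputable def gaussianFiber : Kernel V (RSpace d) :=
  (Kernel.id ×ₖ Kernel.const V (stdGaussian (RSpace d))).map
    (fun p : V × RSpace d => (p.1 : RSpace d) + Vᗮ.starProjection p.2)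

theorem gaussianFiber_apply (v : V) : gaussianFiber V v =
    (stdGaussian (RSpace d)).map (fun x => (v : RSpace d) + Vᗮ.starProjection x) := by
  rw [gaussianFiber, Kernel.map_apply _ (by fun_prop), Kernel.prod_apply, Kernel.id_apply,
    Kernel.const_apply, Measure.dirac_prod, Measure.map_map (by fun_prop) (by fun_prop)]
  rfl

instance : IsMarkovKernel (gaussianFiber V) := by
  unfold gaussianFiber
  exact Kernel.IsMarkovKernel.map _ (by fun_prop)

theorem map_projection_compProd_gaussianFiber :
    (stdGaussian (RSpace d)).map (fun x => (V.orthogonalProjectionOnto x, x)) =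
      (stdGaussian (RSpace d)).map V.orthogonalProjectionOnto ⊗ₘ gaussianFiber V := by
  set γ := stdGaussian (RSpace d)
  have : IsProbabilityMeasure (γ.map V.orthogonalProjectionOnto) :=
    Measure.isProbabilityMeasure_map (by fun_prop)
  have hT : Measurable fun p : V × RSpace d => (p.1, (p.1 : RSpace d) + p.2) := by fun_prop
  have e : (fun x : RSpace d => (V.orthogonalProjectionOnto x, x)) =
      (fun p : V × RSpace d => (p.1, (p.1 : RSpace d) + p.2)) ∘
        fun x => (V.orthogonalProjectionOnto x, Vᗮ.starProjection x) := by
    ext1 x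
    simp only [Function.comp, Prod.mk.injEq, true_and]
    exact (Submodule.starProjection_add_starProjection_orthogonal (K := V) x).symm
  rw [e, ← Measure.map_map hT (by fun_prop), map_projections_stdGaussian]
  ext s hs
  rw [Measure.map_apply hT hs, Measure.prod_apply (hT hs), Measure.compProd_apply hs]
  refine lintegral_congr fun v => ?_
  rw [gaussianFiber_apply, Measure.map_apply (by fun_prop) (hT hs |> measurable_prodMk_left),
    Measure.map_apply (by fun_prop) (measurable_prodMk_left hs)]
  rfl

variable (D : Measure (RSpace d × ℤ))

theorem map_projection_fst_eq (hD : D.map Prod.fst = stdGaussian (RSpace d)) :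
    D.map (fun ω => V.orthogonalProjectionOnto ω.1) =
      (stdGaussian (RSpace d)).map V.orthogonalProjectionOnto := by
  rw [← hD, Measure.map_map (by fun_prop) (by fun_prop)]; rfl

variable [IsProbabilityMeasure D]

instance : IsMarkovKernel (condOnProj D V) := by unfold condOnProj; infer_instance

/-- Uniqueness of regular conditional distributions identifies the abstract conditional law of `x`
with the explicit Gaussian on the fibre, for almost every `v`. -/
theorem condOnProj_map_fst (hD : D.map Prod.fst = stdGaussian (RSpace d)) :
    ∀ᵐ v ∂((stdGaussian (RSpace d)).map V.orthogonalProjectionOnto),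
      (condOnProj D V v).map Prod.fst =
        (stdGaussian (RSpace d)).map (fun x => (v : RSpace d) + Vᗮ.starProjection x) := by
  have h1 := condDistrib_comp (μ := D) (mβ := inferInstance) (fun ω => V.orthogonalProjectionOnto ω.1)
    (Y := fun ω : RSpace d × ℤ => ω) (by fun_prop) (f := Prod.fst) measurable_fst
  have h2 : condDistrib (Prod.fst ∘ fun ω : RSpace d × ℤ => ω)
      (fun ω => V.orthogonalProjectionOnto ω.1) D
      =ᵐ[D.map (fun ω => V.orthogonalProjectionOnto ω.1)] gaussianFiber V := by
    refine condDistrib_ae_eq_of_measure_eq_compProd_of_measurable (by fun_prop) (by fun_prop) ?_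
    rw [map_projection_fst_eq V D hD, ← map_projection_compProd_gaussianFiber, ← hD,
      Measure.map_map (by fun_prop) (by fun_prop)]
    rfl
  rw [map_projection_fst_eq V D hD] at h1 h2
  filter_upwards [h1, h2] with v a b
  rw [← gaussianFiber_apply, ← b, a, Kernel.map_apply _ measurable_fst]
  rfl

theorem lintegral_condOnProj (hD : D.map Prod.fst = stdGaussian (RSpace d))
    {S : Set (RSpace d × ℤ)} (hS : MeasurableSet S) :
    ∫⁻ v, condOnProj D V v S ∂((stdGaussian (RSpace d)).map V.orthogonalProjectionOnto) = D S := by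
  rw [← map_projection_fst_eq V D hD, ← Measure.bind_apply hS (Kernel.aemeasurable _)]
  unfold condOnProj
  rw [condDistrib_comp_map (by fun_prop) (by fun_prop)]
  simp

end ConditionalLaw

/-! ### From correlation with a set to moments of noisy labels. -/

theorem isPolynomialOn_quadratic {d : ℕ} (U : Submodule ℝ (RSpace d)) (e : RSpace d) (a b : ℝ) :
    IsPolynomialOn U 2 fun u => a * ⟪e, (u : RSpace d)⟫_ℝ + b * (1 - ⟪e, (u : RSpace d)⟫_ℝ ^ 2) := by
  set l : MvPolynomial (Fin d) ℝ := ∑ j, MvPolynomial.C (e j) * MvPolynomial.X j with hl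
  have hdeg : l.totalDegree ≤ 1 := by
    refine MvPolynomial.totalDegree_finsetSum_le fun j _ => ?_
    refine (MvPolynomial.totalDegree_mul _ _).trans ?_
    simp
  refine ⟨MvPolynomial.C a * l + MvPolynomial.C b * (MvPolynomial.C 1 - l ^ 2), ?_, fun u => ?_⟩
  · refine (MvPolynomial.totalDegree_add _ _).trans (max_le ?_ ?_)
    · refine (MvPolynomial.totalDegree_mul _ _).trans ?_
      rw [MvPolynomial.totalDegree_C]; omega
    · refine (MvPolynomial.totalDegree_mul _ _).trans ?_
      have h2 := (MvPolynomial.totalDegree_pow l 2)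
      have h3 := MvPolynomial.totalDegree_sub (MvPolynomial.C (σ := Fin d) (1 : ℝ)) (l ^ 2)
      rw [MvPolynomial.totalDegree_C] at h3 ⊢
      omega
  · have : MvPolynomial.eval (fun i => (u : RSpace d) i) l = ⟪e, (u : RSpace d)⟫_ℝ := by
      simp [hl, PiLp.inner_apply, mul_comm]
    simp [this]

/-- A crude uniform `L²` bound suffices, since `S` only enters the constant in `σ`. -/
theorem exists_quadratic_variance_bound : ∃ S : ℝ, 0 < S ∧ ∀ a b : ℝ, a ^ 2 + 2 * b ^ 2 ≤ 4 →
    √(∫ s, (a * s + b * (1 - s ^ 2)) ^ 2 ∂(gaussianReal 0 1)) ≤ S := by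
  have i2 := integrable_pow_gaussianReal 2
  have i4 := integrable_pow_gaussianReal 4
  set M := ∫ s : ℝ, 8 * s ^ 2 + 4 * (1 - 2 * s ^ 2 + s ^ 4) ∂(gaussianReal 0 1)
  refine ⟨√(1 + |M|), by positivity, fun a b h => Real.sqrt_le_sqrt ?_⟩
  have : ∫ s, (a * s + b * (1 - s ^ 2)) ^ 2 ∂(gaussianReal 0 1) ≤ M := by
    refine integral_mono_of_nonneg (ae_of_all _ fun s => by positivity) ?_
      (ae_of_all _ fun s => ?_)
    · exact (i2.const_mul 8).add ((((integrable_const 1).sub (i2.const_mul 2)).add i4).const_mul 4)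
    · simp only
      have h1 : a ^ 2 * s ^ 2 ≤ 4 * s ^ 2 := by gcongr; nlinarith [sq_nonneg b]
      have h2 : b ^ 2 * (1 - s ^ 2) ^ 2 ≤ 2 * (1 - s ^ 2) ^ 2 := by gcongr; nlinarith [sq_nonneg a]
      nlinarith [sq_nonneg (a * s - b * (1 - s ^ 2))]
  linarith [le_abs_self M]

theorem integral_quadratic_gaussianReal (a b : ℝ) :
    ∫ s, (a * s + b * (1 - s ^ 2)) ∂(gaussianReal 0 1) = 0 := by
  have i1 := integrable_id_gaussianReal'
  have i2 := integrable_pow_gaussianReal 2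
  rw [integral_add (i1.const_mul a) (show Integrable (fun s : ℝ => b * (1 - s ^ 2)) _ from
    ((integrable_const 1).sub i2).const_mul b),
    integral_const_mul, integral_const_mul, integral_sub (integrable_const 1) i2,
    integral_id_gaussianReal', integral_sq_gaussianReal]
  simp

theorem inner_starProjection_of_mem {d : ℕ} {U : Submodule ℝ (RSpace d)} {e : RSpace d}
    (he : e ∈ U) (x : RSpace d) : ⟪e, U.starProjection x⟫_ℝ = ⟪e, x⟫_ℝ := by
  rw [← Submodule.inner_starProjection_left_eq_right, Submodule.starProjection_eq_self_iff.2 he]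

/-- Passing from the correlation of a quadratic with a set to its correlation with noisy labels,
conditionally on a projection. -/
theorem correlation_le_of_noise {C₁ : ℝ}
    (H : ∀ (Ω : Type) [MeasurableSpace Ω] (Q : Measure Ω)
      [IsProbabilityMeasure Q] (s : Ω → ℝ) (B : Set Ω) (L : ℝ), Measurable s →
      Q.map s = gaussianReal 0 1 → MeasurableSet B → 0 < L →
      ∫ ω in B, s ω ^ 2 ∂Q ≤ C₁ * (L * Q.real B + Real.exp (-L)) ∧
      ∫ ω in B, |s ω| ∂Q ≤ C₁ * (L * Q.real B + Real.exp (-L)) / √L)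
    {d : ℕ} (V : Submodule ℝ (RSpace d)) (v : V) (κ : Measure (RSpace d × ℤ))
    [IsProbabilityMeasure κ]
    (hκ : κ.map Prod.fst =
      (stdGaussian (RSpace d)).map (fun x => (v : RSpace d) + Vᗮ.starProjection x))
    {A : Set (RSpace d)} (hA : MeasurableSet A) {e : RSpace d} (he : ‖e‖ = 1) (heV : e ∈ Vᗮ)
    (a b : ℝ) {L : ℝ} (hL : 0 < L) :
    ∫ x in {x | (v : RSpace d) + Vᗮ.starProjection x ∈ A}, (a * ⟪e, x⟫_ℝ + b * (1 - ⟪e, x⟫_ℝ ^ 2))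
        ∂(stdGaussian (RSpace d)) ≤
      ∫ ω, (a * ⟪e, ω.1⟫_ℝ + b * (1 - ⟪e, ω.1⟫_ℝ ^ 2)) *
        Set.indicator {k : ℤ | k = 1} (fun _ => (1 : ℝ)) ω.2 ∂κ +
      (|a| * (C₁ * (L * κ.real {ω | A.indicator (fun _ => (1 : ℤ)) ω.1 ≠ ω.2} + Real.exp (-L)) / √L)
        + |b| * (κ.real {ω | A.indicator (fun _ => (1 : ℤ)) ω.1 ≠ ω.2} +
          C₁ * (L * κ.real {ω | A.indicator (fun _ => (1 : ℤ)) ω.1 ≠ ω.2} + Real.exp (-L)))) := by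
  set B : Set (RSpace d × ℤ) := {ω | A.indicator (fun _ => (1 : ℤ)) ω.1 ≠ ω.2} with hB
  have hf : Measurable (A.indicator fun _ => (1 : ℤ)) := measurable_const.indicator hA
  have hBm : MeasurableSet B :=
    (measurableSet_eq_fun (hf.comp measurable_fst) measurable_snd).compl
  set q : ℝ → ℝ := fun s => a * s + b * (1 - s ^ 2) with hq
  have hqm : Measurable q := by fun_prop
  set s : RSpace d × ℤ → ℝ := fun ω => ⟪e, ω.1⟫_ℝ with hs
  have hsm : Measurable s := by fun_prop
  have hev : ∀ x, ⟪e, (v : RSpace d) + Vᗮ.starProjection x⟫_ℝ = ⟪e, x⟫_ℝ := fun x => by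
    rw [inner_add_right, Submodule.inner_left_of_mem_orthogonal v.2 heV, zero_add,
      inner_starProjection_of_mem heV]
  have hTm : Measurable fun x : RSpace d => (v : RSpace d) + Vᗮ.starProjection x := by fun_prop
  have hlaw : κ.map s = gaussianReal 0 1 := by
    have : s = (fun x => ⟪e, x⟫_ℝ) ∘ Prod.fst := rfl
    rw [this, ← Measure.map_map (by fun_prop) (by fun_prop), hκ,
      Measure.map_map (by fun_prop) hTm, ← stdGaussian_map_inner he]
    congr 1; ext x; exact hev x
  have ip : ∀ {g : ℝ → ℝ}, Integrable g (gaussianReal 0 1) → Integrable (fun ω => g (s ω)) κ :=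
    fun hg => (hlaw ▸ hg).comp_measurable hsm
  have i1 : Integrable (fun ω => |s ω|) κ := ip integrable_id_gaussianReal'.abs
  have i2 : Integrable (fun ω => s ω ^ 2) κ := ip (integrable_pow_gaussianReal 2)
  have iq : Integrable (fun ω => q (s ω)) κ :=
    ip ((integrable_id_gaussianReal'.const_mul a).add
      (((integrable_const 1).sub (integrable_pow_gaussianReal 2)).const_mul b))
  have iI : ∀ {S : Set (RSpace d × ℤ)}, MeasurableSet S →
      Integrable (fun ω => q (s ω) * S.indicator (fun _ => (1 : ℝ)) ω) κ := fun hS =>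
    integrable_mul_of_le_one iq (measurable_const.indicator hS).aestronglyMeasurable
      (fun x => Set.indicator_nonneg (fun _ _ => zero_le_one) _)
      (fun x => Set.indicator_le' (fun _ _ => le_rfl) (fun _ _ => zero_le_one) _)
  have hqA : Measurable fun x : RSpace d => q ⟪e, x⟫_ℝ * A.indicator (fun _ => (1 : ℝ)) x :=
    (hqm.comp (by fun_prop)).mul (measurable_const.indicator hA)
  have e1 : ∫ x in {x | (v : RSpace d) + Vᗮ.starProjection x ∈ A}, q ⟪e, x⟫_ℝ
      ∂(stdGaussian (RSpace d)) =
      ∫ ω, q (s ω) * (Prod.fst ⁻¹' A).indicator (fun _ => (1 : ℝ)) ω ∂κ := by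
    have h1 : ∫ ω, q (s ω) * (Prod.fst ⁻¹' A).indicator (fun _ => (1 : ℝ)) ω ∂κ =
        ∫ x, q ⟪e, x⟫_ℝ * A.indicator (fun _ => (1 : ℝ)) x ∂(κ.map Prod.fst) := by
      rw [integral_map measurable_fst.aemeasurable hqA.aestronglyMeasurable]
      rfl
    rw [h1, hκ, integral_map hTm.aemeasurable hqA.aestronglyMeasurable,
      ← integral_indicator (show MeasurableSet {x | (v : RSpace d) + Vᗮ.starProjection x ∈ A} from
        hTm hA)]
    congr 1; ext x
    rw [hev]
    by_cases hx : (v : RSpace d) + Vᗮ.starProjection x ∈ A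
    · rw [Set.indicator_of_mem hx, Set.indicator_of_mem (show x ∈ {x : RSpace d | (v : RSpace d) + Vᗮ.starProjection x ∈ A}
        from hx), mul_one]
    · rw [Set.indicator_of_notMem hx, Set.indicator_of_notMem (show
        x ∉ {x : RSpace d | (v : RSpace d) + Vᗮ.starProjection x ∈ A} from hx),
        mul_zero]
  -- The indicators of `x ∈ A` and `y = 1` can differ only on the mislabelled set `B`, where `|q|`
  -- bounds the discrepancy.
  have hpt : ∀ ω : RSpace d × ℤ, q (s ω) * (Prod.fst ⁻¹' A).indicator (fun _ => (1 : ℝ)) ω ≤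
      q (s ω) * Set.indicator {k : ℤ | k = 1} (fun _ => (1 : ℝ)) ω.2 +
        B.indicator (fun ω => |a| * |s ω| + |b| * (1 + s ω ^ 2)) ω := by
    intro ω
    have hqb : |q (s ω)| ≤ |a| * |s ω| + |b| * (1 + s ω ^ 2) := by
      refine (abs_add_le _ _).trans ?_
      rw [abs_mul, abs_mul]
      gcongr
      rw [abs_le]; constructor <;> nlinarith [sq_nonneg (s ω)]
    have h1 := le_abs_self (q (s ω))
    have h2 := neg_abs_le (q (s ω))
    by_cases hω : ω ∈ B
    · rw [Set.indicator_of_mem hω]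
      by_cases hx : ω.1 ∈ A <;> by_cases hy : ω.2 = 1 <;> simp [hx, hy] <;> linarith
    · rw [Set.indicator_of_notMem hω, add_zero]
      have hω' : A.indicator (fun _ => (1 : ℤ)) ω.1 = ω.2 := not_not.1 hω
      rw [← hω']
      by_cases hx : ω.1 ∈ A <;> simp [hx]
  have iB : Integrable (B.indicator fun ω => |a| * |s ω| + |b| * (1 + s ω ^ 2)) κ :=
    ((i1.const_mul _).add (((integrable_const 1).add i2).const_mul _)).indicator hBm
  have iy : Integrable (fun ω : RSpace d × ℤ =>
      q (s ω) * Set.indicator {k : ℤ | k = 1} (fun _ => (1 : ℝ)) ω.2) κ :=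
    iI (measurable_snd (measurableSet_singleton (1 : ℤ)))
  have hle := integral_mono (iI (measurable_fst hA)) (iy.add iB) hpt
  rw [← e1] at hle
  simp only [Pi.add_apply] at hle
  rw [integral_add iy iB, integral_indicator hBm] at hle
  refine hle.trans ?_
  have e2 : ∫ ω in B, (|a| * |s ω| + |b| * (1 + s ω ^ 2)) ∂κ =
      |a| * ∫ ω in B, |s ω| ∂κ + |b| * (κ.real B + ∫ ω in B, s ω ^ 2 ∂κ) := by
    rw [integral_add (i1.integrableOn.const_mul _)
      (show Integrable (fun ω => |b| * (1 + s ω ^ 2)) _ from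
        ((integrable_const 1).add i2.integrableOn).const_mul _), integral_const_mul,
      integral_const_mul, integral_add (integrable_const 1) i2.integrableOn]
    simp
  rw [e2]
  obtain ⟨H1, H2⟩ := H _ κ s B L hsm hlaw hBm hL
  gcongr

/-- Rounding the conditional probability of a set given a projection. -/
theorem exists_majority {d : ℕ} (V : Submodule ℝ (RSpace d)) {A : Set (RSpace d)}
    (hA : MeasurableSet A) :
    ∃ g : V → ℤ, Measurable g ∧ (∀ v, g v ∈ ({0, 1} : Finset ℤ)) ∧
      stdGaussian (RSpace d)
          {x | g (V.orthogonalProjectionOnto x) ≠ A.indicator (fun _ => (1 : ℤ)) x} =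
        ENNReal.ofReal (∫ v, min ((gaussianFiber V v).real A) (1 - (gaussianFiber V v).real A)
          ∂((stdGaussian (RSpace d)).map V.orthogonalProjectionOnto)) := by
  have hβ : Measurable fun v => (gaussianFiber V v).real A :=
    (Kernel.measurable_coe _ hA).ennreal_toReal
  set S : Set V := {v | 1 / 2 ≤ (gaussianFiber V v).real A}
  have hS : MeasurableSet S := measurableSet_le measurable_const hβ
  have hf : Measurable (A.indicator fun _ => (1 : ℤ)) := measurable_const.indicator hA
  have hg : Measurable (S.indicator fun _ => (1 : ℤ)) := measurable_const.indicator hS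
  have : IsProbabilityMeasure ((stdGaussian (RSpace d)).map V.orthogonalProjectionOnto) :=
    Measure.isProbabilityMeasure_map (by fun_prop)
  have hi : Integrable (fun v => min ((gaussianFiber V v).real A) (1 - (gaussianFiber V v).real A))
      ((stdGaussian (RSpace d)).map V.orthogonalProjectionOnto) := by
    refine Integrable.of_bound (hβ.min (measurable_const.sub hβ)).aestronglyMeasurable 1
      (ae_of_all _ fun v => ?_)
    rw [Real.norm_of_nonneg (le_min measureReal_nonneg (sub_nonneg.2 measureReal_le_one))]
    exact (min_le_left _ _).trans measureReal_le_one
  refine ⟨S.indicator fun _ => 1, hg, fun v => ?_, ?_⟩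
  · by_cases hv : v ∈ S <;> simp [hv]
  · set T : Set (V × RSpace d) := {p | S.indicator (fun _ => (1 : ℤ)) p.1 ≠
      A.indicator (fun _ => (1 : ℤ)) p.2}
    have hT : MeasurableSet T :=
      (measurableSet_eq_fun (hg.comp measurable_fst) (hf.comp measurable_snd)).compl
    have e1 : stdGaussian (RSpace d) {x | S.indicator (fun _ => (1 : ℤ))
        (V.orthogonalProjectionOnto x) ≠ A.indicator (fun _ => (1 : ℤ)) x} =
        (stdGaussian (RSpace d)).map (fun x => (V.orthogonalProjectionOnto x, x)) T := by
      have hP : Measurable fun x : RSpace d => (V.orthogonalProjectionOnto x, x) := by fun_prop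
      rw [Measure.map_apply hP hT]
      rfl
    rw [e1, map_projection_compProd_gaussianFiber, Measure.compProd_apply hT,
      ofReal_integral_eq_lintegral_ofReal hi (ae_of_all _ fun v =>
        le_min measureReal_nonneg (sub_nonneg.2 measureReal_le_one))]
    refine lintegral_congr fun v => ?_
    have hc : (gaussianFiber V v).real Aᶜ = 1 - (gaussianFiber V v).real A :=
      probReal_compl_eq_one_sub hA
    by_cases hv : v ∈ S
    · have : Prod.mk v ⁻¹' T = Aᶜ := by
        ext x
        by_cases hx : x ∈ A <;> simp [T, hv, hx]
      have hv' : 1 / 2 ≤ (gaussianFiber V v).real A := hv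
      rw [this, min_eq_right (by linarith), ← hc, ofReal_measureReal]
    · have : Prod.mk v ⁻¹' T = A := by
        ext x
        by_cases hx : x ∈ A <;> simp [T, hv, hx]
      have hv' : ¬ 1 / 2 ≤ (gaussianFiber V v).real A := hv
      rw [this, min_eq_left (by linarith), ofReal_measureReal]

/-- The noise rate `max ζ (c₀ ε / K)²` is compatible with the error bound. -/
theorem noise_rate_bound {C c₀ K ζ ε : ℝ} (hC : 1 ≤ C) (hc₀ : c₀ = 1 / (20 * C)) (hK : 1 ≤ K)
    (hζ : 0 < ζ) (hζ1 : ζ < 1) (hε : 0 < ε) (hε1 : ε < 1) :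
    max ζ ((c₀ * (ε / K)) ^ 2) ≤ 1 ∧
    C * K * (Real.log (1 / max ζ ((c₀ * (ε / K)) ^ 2) + 1) * ζ + max ζ ((c₀ * (ε / K)) ^ 2)) ≤
      5 / 2 * C * K * (ζ * Real.log (1 / ζ + 1)) + ε / 4 := by
  have hC0 : 0 < C := by linarith
  have hK0 : 0 < K := by linarith
  have hc : 0 < c₀ := by rw [hc₀]; positivity
  have hc1 : c₀ ≤ 1 := by
    rw [hc₀, div_le_one (by positivity)]; linarith
  have hεK : ε / K ≤ 1 := (div_le_one hK0).2 (by linarith)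
  have hcε : c₀ * (ε / K) ≤ 1 := mul_le_one₀ hc1 (by positivity) hεK
  set ζ' := max ζ ((c₀ * (ε / K)) ^ 2) with hζ'
  have h1 : ζ' ≤ 1 := max_le hζ1.le (pow_le_one₀ (by positivity) hcε)
  have h0 : 0 < ζ' := lt_max_of_lt_left hζ
  refine ⟨h1, ?_⟩
  obtain ⟨l1, -, l3, -⟩ := log_inv_add_one_bounds h0 h1
  obtain ⟨l1', -, -, -⟩ := log_inv_add_one_bounds hζ hζ1.le
  set L := Real.log (1 / ζ' + 1) with hL
  have hb : L * ζ + ζ' ≤ 5 / 2 * (ζ' * L) := by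
    have : L * ζ ≤ L * ζ' := by gcongr; exact le_max_left _ _
    nlinarith
  have hb' : C * K * (L * ζ + ζ') ≤ C * K * (5 / 2 * (ζ' * L)) := by gcongr
  rcases max_cases ζ ((c₀ * (ε / K)) ^ 2) with ⟨h, -⟩ | ⟨h, -⟩
  · have e : ζ' = ζ := h
    rw [hL, e] at hb'
    rw [hL, e]
    linarith
  · have e : √ζ' = c₀ * (ε / K) := by
      rw [hζ', h, Real.sqrt_sq (by positivity)]
    rw [e] at l3
    have h2 : C * K * (5 / 2 * (ζ' * L)) ≤ C * K * (5 / 2 * (2 * (c₀ * (ε / K)))) := by gcongr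
    -- The value `c₀ = 1 / (20 C)` is fixed by this identity.
    have h3 : C * K * (5 / 2 * (2 * (c₀ * (ε / K)))) = ε / 4 := by
      rw [hc₀]; field_simp; norm_num
    have h4 : 0 ≤ 5 / 2 * C * K * (ζ * Real.log (1 / ζ + 1)) := by
      have : 0 ≤ Real.log (1 / ζ + 1) := by linarith
      positivity
    linarith

/-- A random variable bounded by one half whose mean exceeds `3 ε / 4` is larger than `ε / 4` with
probability at least `ε`. -/
theorem le_measure_of_lt_integral {Ω : Type*} [MeasurableSpace Ω] {P : Measure Ω}
    [IsProbabilityMeasure P] {h : Ω → ℝ} (hm : Measurable h) (hi : Integrable h P)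
    (h1 : ∀ ω, h ω ≤ 1 / 2) {ε : ℝ} (hε : 0 ≤ ε) (H : 3 * ε / 4 < ∫ ω, h ω ∂P) :
    ENNReal.ofReal ε ≤ P {ω | ε / 4 < h ω} := by
  set G := {ω | ε / 4 < h ω}
  have hG : MeasurableSet G := measurableSet_lt measurable_const hm
  have iG : Integrable (G.indicator fun _ => (1 / 2 : ℝ)) P := (integrable_const _).indicator hG
  have : ∫ ω, h ω ∂P ≤ ∫ ω, (ε / 4 + G.indicator (fun _ => (1 / 2 : ℝ)) ω) ∂P := by
    refine integral_mono hi ((integrable_const _).add iG) fun ω => ?_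
    by_cases hω : ω ∈ G
    · simp only [Set.indicator_of_mem hω]; linarith [h1 ω]
    · simp only [Set.indicator_of_notMem hω]
      have : ¬ ε / 4 < h ω := hω
      linarith
  rw [integral_add (integrable_const _) iG, integral_indicator_const _ hG] at this
  simp only [integral_const, probReal_univ, smul_eq_mul, one_mul] at this
  rw [← ofReal_measureReal (μ := P) (s := G)]
  exact ENNReal.ofReal_le_ofReal (by linarith)

theorem inner_add_starProjection_orthogonal {d : ℕ} (V : Submodule ℝ (RSpace d)) (v : V)
    (w x : RSpace d) (t : ℝ) : ⟪w, (v : RSpace d) + Vᗮ.starProjection x⟫_ℝ + t =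
      ⟪Vᗮ.starProjection w, x⟫_ℝ + (t + ⟪w, (v : RSpace d)⟫_ℝ) := by
  rw [inner_add_right, Submodule.inner_starProjection_left_eq_right]
  ring

theorem measurableSet_polyhedron {d K : ℕ} (w : Fin K → RSpace d) (t : Fin K → ℝ) :
    MeasurableSet {x : RSpace d | ∀ i, 0 ≤ ⟪w i, x⟫_ℝ + t i} := by
  rw [Set.ofPred_forall]
  exact MeasurableSet.iInter fun i => measurableSet_le measurable_const (by fun_prop)

/-- The normalised `Vᗮ`-component of `w ∈ W` lies in `(V + W) ∩ Vᗮ`, so the quadratic in that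
direction is admissible; the label is `z = 1`. -/
theorem hasMoment_of_correlation {C₁ S : ℝ}
    (H : ∀ (Ω : Type) [MeasurableSpace Ω] (Q : Measure Ω)
      [IsProbabilityMeasure Q] (s : Ω → ℝ) (B : Set Ω) (L : ℝ), Measurable s →
      Q.map s = gaussianReal 0 1 → MeasurableSet B → 0 < L →
      ∫ ω in B, s ω ^ 2 ∂Q ≤ C₁ * (L * Q.real B + Real.exp (-L)) ∧
      ∫ ω in B, |s ω| ∂Q ≤ C₁ * (L * Q.real B + Real.exp (-L)) / √L)
    (hS : ∀ a b : ℝ, a ^ 2 + 2 * b ^ 2 ≤ 4 →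
      √(∫ s, (a * s + b * (1 - s ^ 2)) ^ 2 ∂(gaussianReal 0 1)) ≤ S)
    {d : ℕ} {V W : Submodule ℝ (RSpace d)} {D : Measure (RSpace d × ℤ)} [IsProbabilityMeasure D]
    {x₀ : RSpace d}
    (hκ : (condOnProj D V (V.orthogonalProjectionOnto x₀)).map Prod.fst =
      (stdGaussian (RSpace d)).map
        (fun x => (V.orthogonalProjectionOnto x₀ : RSpace d) + Vᗮ.starProjection x))
    {A : Set (RSpace d)} (hA : MeasurableSet A) {w : RSpace d} (hwW : w ∈ W)
    (hw : Vᗮ.starProjection w ≠ 0) {a b : ℝ} (hab : a ^ 2 + 2 * b ^ 2 ≤ 4) {σ L z : ℝ} (hσ : 0 ≤ σ)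
    (hL : 0 < L)
    (hz : (condOnProj D V (V.orthogonalProjectionOnto x₀)).real
      {ω | A.indicator (fun _ => (1 : ℤ)) ω.1 ≠ ω.2} = z)
    (h : σ * S + (|a| * (C₁ * (L * z + Real.exp (-L)) / √L) +
        |b| * (z + C₁ * (L * z + Real.exp (-L)))) <
      ∫ x in {x | (V.orthogonalProjectionOnto x₀ : RSpace d) + Vᗮ.starProjection x ∈ A},
        (a * ⟪‖Vᗮ.starProjection w‖⁻¹ • Vᗮ.starProjection w, x⟫_ℝ +
          b * (1 - ⟪‖Vᗮ.starProjection w‖⁻¹ • Vᗮ.starProjection w, x⟫_ℝ ^ 2))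
          ∂(stdGaussian (RSpace d))) :
    HasMoment {0, 1} 2 σ D V ((V ⊔ W) ⊓ Vᗮ) x₀ := by
  set e := ‖Vᗮ.starProjection w‖⁻¹ • Vᗮ.starProjection w with he
  have he1 : ‖e‖ = 1 := norm_smul_inv_norm (𝕜 := ℝ) hw
  have heV : e ∈ Vᗮ := Submodule.smul_mem _ _ (Submodule.starProjection_apply_mem _ _)
  have heU : e ∈ (V ⊔ W) ⊓ Vᗮ := by
    refine ⟨Submodule.smul_mem _ _ ?_, heV⟩
    rw [Submodule.starProjection_orthogonal_val]
    exact Submodule.sub_mem _ (Submodule.mem_sup_right hwW)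
      (Submodule.mem_sup_left (Submodule.starProjection_apply_mem _ _))
  have hin : ∀ x : RSpace d, ⟪e, (((V ⊔ W) ⊓ Vᗮ).orthogonalProjectionOnto x : RSpace d)⟫_ℝ =
      ⟪e, x⟫_ℝ := inner_starProjection_of_mem heU
  refine ⟨fun u => a * ⟪e, (u : RSpace d)⟫_ℝ + b * (1 - ⟪e, (u : RSpace d)⟫_ℝ ^ 2),
    isPolynomialOn_quadratic _ e a b, 1, by simp, ?_, ?_⟩
  · simp only [hin]
    rw [integral_comp_inner_stdGaussian he1 (ψ := fun s => a * s + b * (1 - s ^ 2)) (by fun_prop)]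
    exact integral_quadratic_gaussianReal a b
  · simp only [hin]
    rw [integral_comp_inner_stdGaussian he1 (ψ := fun s => (a * s + b * (1 - s ^ 2)) ^ 2)
      (by fun_prop)]
    have h1 := correlation_le_of_noise H V (V.orthogonalProjectionOnto x₀) _ hκ hA he1 heV a b hL
    rw [hz] at h1
    have h2 := mul_le_mul_of_nonneg_left (hS a b hab) hσ
    linarith

/-! ### Assembly of the proposition. -/

theorem multiclassSurfaceArea_indicator {d : ℕ} (A : Set (RSpace d)) :
    multiclassSurfaceArea {0, 1} (A.indicator fun _ => (1 : ℤ)) =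
      gaussianSurfaceArea Aᶜ + gaussianSurfaceArea A := by
  have h0 : {x | A.indicator (fun _ => (1 : ℤ)) x = 0} = Aᶜ := by
    ext x; by_cases hx : x ∈ A <;> simp [hx]
  have h1 : {x | A.indicator (fun _ => (1 : ℤ)) x = 1} = A := by
    ext x; by_cases hx : x ∈ A <;> simp [hx]
  rw [multiclassSurfaceArea, Finset.sum_pair (by norm_num), h0, h1]

theorem multiclassSurfaceArea_polyhedron_le {d K : ℕ} (hK : 0 < K) (w : Fin K → RSpace d)
    (t : Fin K → ℝ) :
    multiclassSurfaceArea {0, 1}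
      (Set.indicator {x : RSpace d | ∀ i, 0 ≤ ⟪w i, x⟫_ℝ + t i} fun _ => (1 : ℤ)) ≤
    ENNReal.ofReal (2 * (Real.exp 7 + 2) * √(Real.log (K + 1))) := by
  obtain ⟨h1, h2⟩ := gaussianSurfaceArea_polyhedron_le hK w t
  rw [multiclassSurfaceArea_indicator]
  refine (add_le_add h2 h1).trans ?_
  rw [← ENNReal.ofReal_add (by positivity) (by positivity)]
  exact ENNReal.ofReal_le_ofReal (by linarith)

theorem proposition4p2 :
    ∃ (C c : ℝ) (q : ℕ), 0 < C ∧ 0 < c ∧ c < 1 ∧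
      ∀ (d K : ℕ) (ζ ε : ℝ), 0 < d → 0 < K → 0 < ζ → ζ < 1 → 0 < ε → ε < 1 →
        IsWellBehaved ({0, 1} : Finset ℤ) (intersectionsOfHalfspaces K d) 2 ζ ε K
          (C * K * (ζ * Real.log (1 / ζ + 1)) + ε)
          (c * (ε / K) ^ q)
          (C * √(Real.log (K + 1))) := by
  obtain ⟨C₁, hC₁, H⟩ := exists_noise_bound
  obtain ⟨S, hS0, hS⟩ := exists_quadratic_variance_bound
  obtain ⟨C, c₁, hC, hc₁, hcorr⟩ := exists_quadratic_correlation C₁ hC₁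
  have hC0 : 0 < C := by linarith
  set c₀ := 1 / (20 * C) with hc₀
  have hc₀0 : 0 < c₀ := by positivity
  set m := min c₁ (c₀ / 8) with hm
  have hm0 : 0 < m := lt_min hc₁ (by positivity)
  -- One constant serves both the error bound and the surface area. Dividing `m` by `S` in the next
  -- witness absorbs the `L²` norm of the quadratic.
  set M := max (5 / 2 * C) (2 * (Real.exp 7 + 2)) with hM
  refine ⟨M, min (m / S) (1 / 2), 2, lt_max_of_lt_left (by positivity),
    lt_min (by positivity) (by norm_num), (min_le_right _ _).trans_lt (by norm_num), ?_⟩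
  rintro d K ζ ε - hK hζ hζ1 hε hε1 f ⟨w, t, rfl⟩
  set A := {x : RSpace d | ∀ i, 0 ≤ ⟪w i, x⟫_ℝ + t i} with hAdef
  have hA : MeasurableSet A := measurableSet_polyhedron w t
  have hf : Measurable (A.indicator fun _ => (1 : ℤ)) := measurable_const.indicator hA
  refine ⟨hf, fun x => by by_cases hx : x ∈ A <;> simp [hx], ?_,
    Submodule.span ℝ (Set.range w), ?_, fun x => ?_, ?_⟩
  · refine (multiclassSurfaceArea_polyhedron_le hK w t).trans (ENNReal.ofReal_le_ofReal ?_)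
    gcongr
    exact le_max_right _ _
  · simpa [Set.finrank] using finrank_range_le_card (R := ℝ) w
  · have : x ∈ A ↔ (((Submodule.span ℝ (Set.range w)).orthogonalProjectionOnto x : RSpace d)) ∈ A := by
      have h : ∀ i, ⟪w i, ((Submodule.span ℝ (Set.range w)).orthogonalProjectionOnto x :
          RSpace d)⟫_ℝ = ⟪w i, x⟫_ℝ := fun i =>
        inner_starProjection_of_mem (Submodule.subset_span (Set.mem_range_self i)) x
      simp only [hAdef, Set.mem_ofPred_eq, h]
    by_cases hx : x ∈ A
    · rw [Set.indicator_of_mem hx, Set.indicator_of_mem (this.1 hx)]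
    · rw [Set.indicator_of_notMem hx, Set.indicator_of_notMem (fun h => hx (this.2 h))]
  intro D _ hD hDζ V
  rw [or_iff_not_imp_left]
  intro hno
  set γ := stdGaussian (RSpace d) with hγ
  have hlaw : IsProbabilityMeasure (γ.map V.orthogonalProjectionOnto) :=
    Measure.isProbabilityMeasure_map (by fun_prop)
  set law := γ.map V.orthogonalProjectionOnto with hlawdef
  obtain ⟨g, hgm, hg01, hg⟩ := exists_majority V hA
  have hK1 : (1 : ℝ) ≤ K := by exact_mod_cast hK
  obtain ⟨hζ'1, hrate⟩ := noise_rate_bound hC hc₀ hK1 hζ hζ1 hε hε1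
  set ζ' := max ζ ((c₀ * (ε / K)) ^ 2) with hζ'
  have hζ'0 : 0 < ζ' := lt_max_of_lt_left hζ
  obtain ⟨l1, -, -, l4⟩ := log_inv_add_one_bounds hζ'0 hζ'1
  set L := Real.log (1 / ζ' + 1) with hL
  have hL0 : 0 < L := by linarith
  set η : V → ℝ := fun v => min ((gaussianFiber V v).real A) (1 - (gaussianFiber V v).real A)
  -- Otherwise the rounded conditional probability would be the function required in (a).
  have hτ : M * K * (ζ * Real.log (1 / ζ + 1)) + ε < ∫ v, η v ∂law := by
    by_contra hle
    exact hno ⟨g, hgm, hg01, hg.trans_le (ENNReal.ofReal_le_ofReal (not_lt.1 hle))⟩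
  set B : Set (RSpace d × ℤ) := {ω | A.indicator (fun _ => (1 : ℤ)) ω.1 ≠ ω.2} with hB
  have hBm : MeasurableSet B :=
    (measurableSet_eq_fun (hf.comp measurable_fst) measurable_snd).compl
  set z : V → ℝ := fun v => (condOnProj D V v).real B with hz
  have hzm : Measurable z := (Kernel.measurable_coe _ hBm).ennreal_toReal
  have hzi : Integrable z law := Integrable.of_bound hzm.aestronglyMeasurable 1
    (ae_of_all _ fun v => by rw [Real.norm_of_nonneg measureReal_nonneg]; exact measureReal_le_one)
  have hzint : ∫ v, z v ∂law ≤ ζ := by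
    rw [integral_eq_lintegral_of_nonneg_ae (ae_of_all _ fun v => measureReal_nonneg)
      hzm.aestronglyMeasurable]
    refine ENNReal.toReal_le_of_le_ofReal hζ.le ?_
    have e : ∀ v, ENNReal.ofReal (z v) = condOnProj D V v B := fun v => ofReal_measureReal
    rw [lintegral_congr e, lintegral_condOnProj V D hD.marginal hBm]
    exact hDζ
  have hβm : Measurable fun v => (gaussianFiber V v).real A :=
    (Kernel.measurable_coe _ hA).ennreal_toReal
  have hηm : Measurable η := hβm.min (measurable_const.sub hβm)
  have hη1 : ∀ v, η v ≤ 1 / 2 := fun v => by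
    rcases le_total ((gaussianFiber V v).real A) (1 / 2) with h | h
    · exact (min_le_left _ _).trans h
    · exact (min_le_right _ _).trans (by linarith)
  have hη0 : ∀ v, 0 ≤ η v := fun v => le_min measureReal_nonneg (sub_nonneg.2 measureReal_le_one)
  have hηi : Integrable η law := Integrable.of_bound hηm.aestronglyMeasurable (1 / 2)
    (ae_of_all _ fun v => by rw [Real.norm_of_nonneg (hη0 v)]; exact hη1 v)
  have hni : Integrable (fun v => C * K * (L * z v + ζ')) law :=
    ((hzi.const_mul L).add (integrable_const ζ')).const_mul _
  -- The mean of `η` exceeds `τ`, and the mean noise penalty is at most `τ - ε + ε / 4`, leaving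
  -- more than `3 ε / 4`. The affine dependence on `z` allows the penalty to be averaged.
  have hgood : ENNReal.ofReal ε ≤ law {v | ε / 4 < η v - C * K * (L * z v + ζ')} := by
    refine le_measure_of_lt_integral (h := fun v => η v - C * K * (L * z v + ζ')) (by fun_prop)
      (hηi.sub hni) (fun v => ?_) hε.le ?_
    · have : 0 ≤ C * K * (L * z v + ζ') := by
        have : 0 ≤ z v := measureReal_nonneg
        positivity
      linarith [hη1 v]
    · rw [integral_sub hηi hni, integral_const_mul, integral_add (hzi.const_mul L)
        (integrable_const ζ'), integral_const_mul]
      simp only [integral_const, probReal_univ, smul_eq_mul, one_mul]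
      have h1 : C * K * (L * ∫ v, z v ∂law + ζ') ≤ C * K * (L * ζ + ζ') := by gcongr
      have h2 : 5 / 2 * C * K * (ζ * Real.log (1 / ζ + 1)) ≤
          M * K * (ζ * Real.log (1 / ζ + 1)) := by
        have : 0 ≤ Real.log (1 / ζ + 1) := by
          linarith [(log_inv_add_one_bounds hζ hζ1.le).1]
        gcongr
        exact le_max_left _ _
      linarith
  have hGm : MeasurableSet {v | ε / 4 < η v - C * K * (L * z v + ζ')} :=
    measurableSet_lt measurable_const (by fun_prop)
  rw [hlawdef, Measure.map_apply (by fun_prop) hGm] at hgood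
  refine hgood.trans (measure_mono_ae ?_)
  have hκ := ae_of_ae_map (by fun_prop) (condOnProj_map_fst V D hD.marginal)
  filter_upwards [hκ] with x₀ hκ hx₀
  set v := V.orthogonalProjectionOnto x₀ with hv
  have hx₀' : C * K * (L * z v + ζ') + ε / 4 < η v := by
    have : ε / 4 < η v - C * K * (L * z v + ζ') := hx₀
    linarith
  -- Restricted to the fibre, the set is again an intersection of `K` halfspaces, with projected
  -- normals and thresholds shifted by `v`.
  have hset : {x | (v : RSpace d) + Vᗮ.starProjection x ∈ A} =
      {x | ∀ i, 0 ≤ ⟪Vᗮ.starProjection (w i), x⟫_ℝ + (t i + ⟪w i, (v : RSpace d)⟫_ℝ)} := by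
    ext x
    simp only [hAdef, Set.mem_ofPred_eq, inner_add_starProjection_orthogonal]
  have hfib : (gaussianFiber V v).real A =
      γ.real {x | ∀ i, 0 ≤ ⟪Vᗮ.starProjection (w i), x⟫_ℝ + (t i + ⟪w i, (v : RSpace d)⟫_ℝ)} := by
    rw [gaussianFiber_apply, map_measureReal_apply (by fun_prop) hA, ← hset]
    rfl
  obtain ⟨i, hi, a, b, hab, hlt⟩ := hcorr c₀ hc₀0 d K (fun i => Vᗮ.starProjection (w i))
    (fun i => t i + ⟪w i, (v : RSpace d)⟫_ℝ) (z v) ζ' ε hK measureReal_nonneg hζ'0 hζ'1 hε hε1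
    (le_max_right _ _) (by rw [← hfib]; exact hx₀')
  rw [← hset] at hlt
  refine hasMoment_of_correlation H hS hκ hA (Submodule.subset_span (Set.mem_range_self i)) hi hab
    (by positivity) hL0 rfl (lt_of_le_of_lt ?_ hlt)
  have hz0 : 0 ≤ z v := measureReal_nonneg
  have h1 : min (m / S) (1 / 2) * (ε / K) ^ 2 * S ≤ m * (ε / K) ^ 2 := by
    calc _ ≤ m / S * (ε / K) ^ 2 * S := by gcongr; exact min_le_left _ _
      _ = m * (ε / K) ^ 2 := by field_simp
  -- What remains is monotonicity, with `exp (-L) ≤ ζ'` in the noise terms and `h1` for the margin.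
  change _ + (|a| * (C₁ * (L * z v + Real.exp (-L)) / √L) +
    |b| * (z v + C₁ * (L * z v + Real.exp (-L)))) ≤ _
  gcongr
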